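/- Let $0<\nu<1$, $\mu=1-\nu$, $\delta\in\mathbb R$. For $N\in\mathbb N$ let $0\le C_N\le N$ be integers with $C_N=\nu N+\delta\sqrt N+o(\sqrt N)$ as $N\to\infty$, and let $(X_N(t))_{t\ge 0}$ be the Engset process, i.e. the right-continuous Markov jump process on $\{0,1,\dots,C_N\}$ with transition rates $q(x,x+1)=\nu(N-x)$ for $x<C_N$ and $q(x,x-1)=\mu x$, started at $X_N(0)=0$. Let $T_{C_N}=\inf\{s\ge 0: X_N(s)=C_N\}$. Then $T_{C_N}<\infty$ almost surely, and as $N\to\infty$ the random variables $T_{C_N}-\tfrac12\log N$ converge in distribution to a real random variable $Z$ such that, for every $\alpha>0$, $e^{-\alpha Z}$ is integrable and $$\mathbb E\left(e^{-\alpha Z}\right)=\Gamma(\alpha)\Big/\int_0^{+\infty}\exp\left(u\frac{\delta}{\nu}-\frac{u^2}{2}\,\frac{1-\nu}{\nu}\right)u^{\alpha-1}\,du .$$ If $\delta=0$, the random variable $Z-\tfrac12\log\left(\nu/(1-\nu)\right)$ has density $x\mapsto\sqrt{2/\pi}\,\exp\left(-x-e^{-2x}/2\right)$ on $\mathbb R$.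 -/

import Mathlib

open MeasureTheory ProbabilityTheory Filter Topology Asymptotics
open scoped NNReal

/-- `X` is, under `P`, a continuous-time Markov jump process on the finite set `S` (with the
discrete topology) with `Q`-matrix `Q`, started at `x₀`: its paths are almost surely
right-continuous, and it has the Markov property with transition semigroup `t ↦ exp (t Q)`,
written out on the finite-dimensional distributions. -/
structure IsMarkovJumpProcess {S Ω : Type*} [Fintype S] [DecidableEq S] [MeasurableSpace Ω]
    (Q : Matrix S S ℝ) (x₀ : S) (X : ℝ≥0 → Ω → S) (P : Measure Ω) : Prop where
  measurableSet_eq : ∀ (t : ℝ≥0) (x : S), MeasurableSet {ω | X t ω = x}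
  initial : ∀ᵐ ω ∂P, X 0 ω = x₀
  rightContinuous : ∀ᵐ ω ∂P, ∀ t : ℝ≥0, ∀ᶠ s in 𝓝[≥] t, X s ω = X t ω
  markov : ∀ (n : ℕ) (t : ℕ → ℝ≥0) (x : ℕ → S), Monotone t →
    P.real {ω | ∀ i ≤ n + 1, X (t i) ω = x i} =
      P.real {ω | ∀ i ≤ n, X (t i) ω = x i} *
        NormedSpace.exp (((t (n + 1) : ℝ) - (t n : ℝ)) • Q) (x n) (x (n + 1))

/-- The `Q`-matrix of the Engset process with `N` sources and capacity `C` on `{0, …, C}`: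
births `x → x + 1` at rate `ν (N - x)` when `x < C`, deaths `x → x - 1` at rate `μ x`. The diagonal
entries make the rows sum to zero. -/
noncomputable def engsetQ (ν μ : ℝ) (N C : ℕ) : Matrix (Fin (C + 1)) (Fin (C + 1)) ℝ :=
  Matrix.of fun x y =>
    if (y : ℕ) = x + 1 then ν * ((N : ℝ) - (x : ℕ))
    else if (y : ℕ) + 1 = x then μ * (x : ℕ)
    else if y = x then
      -((if (x : ℕ) < C then ν * ((N : ℝ) - (x : ℕ)) else 0) + μ * (x : ℕ))
    else 0

/-- The first time `T = inf {s ≥ 0 : X s = C}` at which a process on `{0, …, C}` reaches `C`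
(`⊤` if it never does). -/
noncomputable def blockingTime {Ω : Type*} {C : ℕ} (X : ℝ≥0 → Ω → Fin (C + 1)) :
    Ω → WithTop ℝ≥0 :=
  hittingAfter X {Fin.last C} 0

/-! Write `μ = 1 - ν`. The proof rests on an explicit eigenfunction. The kernel `k x u = (1 - ν
u)^(N - x) (1 + μ u)^x` is chosen so that, at states below capacity, the generator acting in `x`
gives `-u ∂k/∂u`. Integrating against `u^(α - 1)` over `(0, 1/ν)` and then by parts turns this into
multiplication by `α` (`engsetEigen_recurrence`). So `f x = ∫ k x u u^(α - 1) du` satisfies `Q f = α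
f` off the capacity, and optional stopping yields `E exp (-α T) = f 0 / f C`
(`IsMarkovJumpProcess.integral_discountedHitting_mul`, `integral_discountedHitting_engset`).

Optional stopping is proved by hand from the finite-dimensional distributions: on a time grid of
mesh `h` the martingale identity holds up to an error that vanishes with `h`, and right-continuity
lets the grid hitting times converge to the true one. Since `α f x → 1` as `α → 0+` for every `x`,
the ratio tends to `1`, which is almost sure finiteness.

For the limit law, Laplace's method gives `f 0 ~ Γ(α) (ν N)^(-α)` (`tendsto_engsetEigen_zero`) and
`f C ~ I(α) (ν √N)^(-α)`, with `I(α)` the Gaussian-type integral of the statement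
(`tendsto_engsetEigen_capacity`). The quotient of the powers is `N^(-α/2)`, whence the centring by
`log N / 2`. The recentred times are not uniformly bounded below and only `α > 0` is available, so a
dedicated continuity theorem is needed (`exists_tendsto_of_tendsto_laplace`): tightness comes from
`Γ(α) / I(α) → 1` as `α → 0+`, uniqueness from analytic continuation to a half-plane and passage to
its boundary. For `δ = 0`, `I(α)` is a Gamma value, and the duplication formula identifies the law.
-/

/-! ### Laplace transforms on `(0, ∞)` and convergence in law. -/

/-- Probability measures on `ℝ` with the same finite Laplace transform on `(0, ∞)` are equal. -/
theorem ext_of_integral_exp_neg_mul_eq {μ ρ : Measure ℝ} [IsProbabilityMeasure μ]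
    [IsProbabilityMeasure ρ]
    (hμ : ∀ α : ℝ, 0 < α → Integrable (fun x => Real.exp (-α * x)) μ)
    (hρ : ∀ α : ℝ, 0 < α → Integrable (fun x => Real.exp (-α * x)) ρ)
    (h : ∀ α : ℝ, 0 < α → ∫ x, Real.exp (-α * x) ∂μ = ∫ x, Real.exp (-α * x) ∂ρ) : μ = ρ := by
  have hset : ∀ κ : Measure ℝ, (∀ α : ℝ, 0 < α → Integrable (fun x => Real.exp (-α * x)) κ) →
      ∀ z : ℂ, z.re < 0 → z.re ∈ interior (integrableExpSet id κ) := by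
    intro κ hκ z hz
    refine interior_maximal (s := integrableExpSet id κ) (t := Set.Iio 0) ?_ isOpen_Iio hz
    intro t ht
    simpa [integrableExpSet] using hκ (-t) (by simpa using ht)
  have hopen : Convex ℝ {z : ℂ | z.re < 0} := convex_halfSpace_re_lt 0
  -- Identity theorem: both transforms are analytic on the open left half-plane and agree on the
  -- negative reals, which accumulate at `-1`.
  have heq : Set.EqOn (complexMGF id μ) (complexMGF id ρ) {z : ℂ | z.re < 0} := by
    refine AnalyticOnNhd.eqOn_of_preconnected_of_frequently_eq
      (analyticOnNhd_complexMGF.mono fun z hz => hset μ hμ z hz)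
      (analyticOnNhd_complexMGF.mono fun z hz => hset ρ hρ z hz)
      hopen.isPreconnected (z₀ := ((-1 : ℝ) : ℂ)) (by simp) ?_
    have h_real : ∃ᶠ (x : ℝ) in 𝓝[≠] (-1), complexMGF id μ x = complexMGF id ρ x := by
      refine Eventually.frequently ?_
      have : ∀ᶠ x : ℝ in 𝓝[≠] (-1), x < 0 :=
        (eventually_lt_nhds (by norm_num)).filter_mono nhdsWithin_le_nhds
      filter_upwards [this] with x hx
      rw [complexMGF_ofReal, complexMGF_ofReal]
      congr 1
      simpa [mgf] using h (-x) (by linarith)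
    rw [frequently_iff_seq_forall] at h_real ⊢
    obtain ⟨xs, hx_tendsto, hx_eq⟩ := h_real
    refine ⟨fun n ↦ xs n, ?_, fun n ↦ by simpa using hx_eq n⟩
    rw [tendsto_nhdsWithin_iff] at hx_tendsto ⊢
    refine ⟨(Complex.continuous_ofReal.tendsto _).comp hx_tendsto.1, ?_⟩
    filter_upwards [hx_tendsto.2] with n hn
    simp only [Set.mem_compl_iff, Set.mem_singleton_iff] at hn ⊢
    exact_mod_cast hn
  -- The imaginary axis, where the characteristic function lives, is only the boundary of the
  -- half-plane. It is approached along `-1/(n+1) + iξ`; the real exponentials stay below `1 + exp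
  -- (-x)`.
  have hlim : ∀ κ : Measure ℝ, IsProbabilityMeasure κ →
      (∀ α : ℝ, 0 < α → Integrable (fun x => Real.exp (-α * x)) κ) → ∀ ξ : ℝ,
      Tendsto (fun n : ℕ => complexMGF id κ (-(1 / ((n : ℝ) + 1) : ℝ) + ξ * Complex.I)) atTop
        (𝓝 (charFun κ ξ)) := by
    intro κ _ hκ ξ
    rw [← complexMGF_id_mul_I]
    unfold complexMGF
    refine tendsto_integral_of_dominated_convergence (fun x => 1 + Real.exp (-1 * x))
      (fun n => by fun_prop) ((integrable_const 1).add (hκ 1 one_pos)) (fun n => ?_) ?_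
    · refine Eventually.of_forall fun x => ?_
      rw [Complex.norm_exp]
      have h0 : (0 : ℝ) < 1 / ((n : ℝ) + 1) := by positivity
      have h1 : 1 / ((n : ℝ) + 1) ≤ 1 := by
        rw [div_le_one (by positivity)]; linarith [(Nat.cast_nonneg n : (0 : ℝ) ≤ n)]
      have : ((-((1 / ((n : ℝ) + 1) : ℝ) : ℂ) + ξ * Complex.I) * (id x : ℝ)).re
          = -(1 / ((n : ℝ) + 1)) * x := by
        rw [Complex.re_mul_ofReal, Complex.add_re, Complex.neg_re, Complex.ofReal_re]; simp
      rw [this]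
      rcases le_total 0 x with hx | hx
      · have : Real.exp (-(1 / ((n : ℝ) + 1)) * x) ≤ 1 := by
          rw [Real.exp_le_one_iff]; nlinarith
        linarith [Real.exp_pos (-1 * x)]
      · have : Real.exp (-(1 / ((n : ℝ) + 1)) * x) ≤ Real.exp (-1 * x) := by
          rw [Real.exp_le_exp]; nlinarith
        linarith
    · refine Eventually.of_forall fun x => ?_
      have h0 : Tendsto (fun n : ℕ => ((1 / ((n : ℝ) + 1) : ℝ) : ℂ)) atTop (𝓝 ((0 : ℝ) : ℂ)) :=
        (Complex.continuous_ofReal.tendsto _).comp tendsto_one_div_add_atTop_nhds_zero_nat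
      have h1 := ((h0.neg.add_const (ξ * Complex.I)).mul_const ((id x : ℝ) : ℂ))
      have h2 := (Complex.continuous_exp.tendsto _).comp h1
      simpa [Function.comp_def] using h2
  refine Measure.ext_of_charFun (funext fun ξ => ?_)
  refine tendsto_nhds_unique (hlim μ ‹_› hμ ξ) ((hlim ρ ‹_› hρ ξ).congr fun n => ?_)
  refine (heq ?_).symm
  have h0 : (0 : ℝ) < 1 / ((n : ℝ) + 1) := by positivity
  simp only [Set.mem_ofPred_eq, Complex.add_re, Complex.neg_re, Complex.ofReal_re, Complex.mul_re,
    Complex.I_re, Complex.ofReal_im, Complex.I_im]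
  linarith

/-- If the Laplace transforms of probability measures on `ℝ` converge on `(0, ∞)` to a function
tending to `1` at `0`, then the measures are tight. -/
theorem isTightMeasureSet_range_of_tendsto_laplace (μs : ℕ → ProbabilityMeasure ℝ) (M : ℝ → ℝ)
    (hint : ∀ n, ∀ α : ℝ, 0 < α → Integrable (fun x => Real.exp (-α * x)) (μs n : Measure ℝ))
    (hM : ∀ α : ℝ, 0 < α →
      Tendsto (fun n => ∫ x, Real.exp (-α * x) ∂(μs n : Measure ℝ)) atTop (𝓝 (M α)))
    (hM0 : Tendsto M (𝓝[>] 0) (𝓝 1)) :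
    IsTightMeasureSet (Set.range fun n => (μs n : Measure ℝ)) := by
  refine isTightMeasureSet_range_of_tendsto_limsup_measure_norm_gt ?_
  rw [ENNReal.tendsto_atTop_zero]
  intro ε hε
  obtain ⟨e, he0, he⟩ : ∃ e : ℝ, 0 < e ∧ ENNReal.ofReal e ≤ ε := by
    rcases eq_or_ne ε ⊤ with rfl | hne
    · exact ⟨1, one_pos, le_top⟩
    · exact ⟨ε.toReal, ENNReal.toReal_pos hε.ne' hne, by rw [ENNReal.ofReal_toReal hne]⟩
  have hdouble : Tendsto (fun α : ℝ => 2 * α) (𝓝[>] 0) (𝓝[>] 0) := by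
    rw [tendsto_nhdsWithin_iff]
    refine ⟨?_, ?_⟩
    · have : Tendsto (fun α : ℝ => 2 * α) (𝓝 0) (𝓝 (2 * 0)) := by
        exact (continuous_const.mul continuous_id).tendsto 0
      rw [mul_zero] at this
      exact this.mono_left nhdsWithin_le_nhds
    · filter_upwards [self_mem_nhdsWithin] with α hα
      have : (0 : ℝ) < α := hα
      simpa using this
  -- `M (2α) - 2 M α + 1` is the limit of the means of `(1 - exp (-α x))^2`, so its smallness
  -- permits a Chebyshev bound on both tails at once.
  have hsmall : Tendsto (fun α => M (2 * α) - 2 * M α + 1) (𝓝[>] 0) (𝓝 (1 - 2 * 1 + 1)) :=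
    ((hM0.comp hdouble).sub (hM0.const_mul 2)).add_const 1
  norm_num at hsmall
  obtain ⟨α, hα, hα0⟩ := ((hsmall.eventually_lt_const (show (0 : ℝ) < e / 4 by positivity)).and
    self_mem_nhdsWithin).exists
  have hα0 : 0 < α := hα0
  have hn : ∀ᶠ n in atTop, (∫ x, Real.exp (-(2 * α) * x) ∂(μs n : Measure ℝ))
      - 2 * (∫ x, Real.exp (-α * x) ∂(μs n : Measure ℝ)) + 1 < e / 4 :=
    (((hM (2 * α) (by positivity)).sub ((hM α hα0).const_mul 2)).add_const 1).eventually_lt_const hα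
  -- Beyond `log 2 / α` in absolute value, `exp (-α x)` is at most `1/2` or at least `2`, so its
  -- squared distance to `1` is at least `1/4`.
  refine ⟨Real.log 2 / α, fun r hr => ?_⟩
  refine (Filter.limsup_le_of_le (h := ?_)).trans he
  filter_upwards [hn] with n hn
  have hr' : Real.log 2 ≤ α * r := by
    rw [ge_iff_le, div_le_iff₀ hα0] at hr; linarith
  have hsub : {x : ℝ | r < ‖x‖} ⊆ {x | (1 / 4 : ℝ) ≤ (1 - Real.exp (-α * x)) ^ 2} := by
    intro x hx
    simp only [Set.mem_ofPred_eq, Real.norm_eq_abs] at hx ⊢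
    rcases le_total 0 x with h0 | h0
    · rw [abs_of_nonneg h0] at hx
      have : Real.exp (-α * x) ≤ Real.exp (-Real.log 2) := by
        rw [Real.exp_le_exp]; nlinarith
      rw [Real.exp_neg, Real.exp_log (by norm_num)] at this
      nlinarith
    · rw [abs_of_nonpos h0] at hx
      have : Real.exp (Real.log 2) ≤ Real.exp (-α * x) := by
        rw [Real.exp_le_exp]; nlinarith
      rw [Real.exp_log (by norm_num)] at this
      nlinarith
  have hexp : ∀ x : ℝ, (1 - Real.exp (-α * x)) ^ 2
      = Real.exp (-(2 * α) * x) - 2 * Real.exp (-α * x) + 1 := by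
    intro x
    rw [show -(2 * α) * x = -α * x + -α * x by ring, Real.exp_add]; ring
  have hi2 := hint n (2 * α) (by positivity)
  have hi1 := hint n α hα0
  have hI : Integrable (fun x => (1 - Real.exp (-α * x)) ^ 2) (μs n : Measure ℝ) := by
    simp_rw [hexp]
    exact (hi2.sub (hi1.const_mul 2)).add (integrable_const 1)
  have hmark := mul_meas_ge_le_integral_of_nonneg (μ := (μs n : Measure ℝ))
    (f := fun x => (1 - Real.exp (-α * x)) ^ 2) (Eventually.of_forall fun x => sq_nonneg _) hI (1 / 4)
  have hval : ∫ x, (1 - Real.exp (-α * x)) ^ 2 ∂(μs n : Measure ℝ) < e / 4 := by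
    simp_rw [hexp]
    have hsub' : Integrable
        (fun x => Real.exp (-(2 * α) * x) - 2 * Real.exp (-α * x)) (μs n : Measure ℝ) :=
      hi2.sub (hi1.const_mul 2)
    rw [integral_add hsub' (integrable_const 1),
      integral_sub hi2 (hi1.const_mul 2), integral_const_mul]
    simpa using hn
  refine (measure_mono hsub).trans ?_
  rw [ENNReal.le_ofReal_iff_toReal_le (measure_ne_top _ _) he0.le]
  change (μs n : Measure ℝ).real _ ≤ e
  linarith

/-- The Laplace transform of a weak limit is the limit of the Laplace transforms, when these
converge on `(0, ∞)`. -/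
theorem integral_exp_neg_mul_of_tendsto {l : Filter ℕ} [l.NeBot] (μs : ℕ → ProbabilityMeasure ℝ)
    (M : ℝ → ℝ) (ρ : ProbabilityMeasure ℝ)
    (hint : ∀ n, ∀ α : ℝ, 0 < α → Integrable (fun x => Real.exp (-α * x)) (μs n : Measure ℝ))
    (hM : ∀ α : ℝ, 0 < α →
      Tendsto (fun n => ∫ x, Real.exp (-α * x) ∂(μs n : Measure ℝ)) l (𝓝 (M α)))
    (hρ : Tendsto μs l (𝓝 ρ)) {α : ℝ} (hα : 0 < α) :
    Integrable (fun x => Real.exp (-α * x)) (ρ : Measure ℝ) ∧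
      ∫ x, Real.exp (-α * x) ∂(ρ : Measure ℝ) = M α := by
  rw [ProbabilityMeasure.tendsto_iff_forall_integral_tendsto] at hρ
  have hmin_int : ∀ (κ : Measure ℝ) [IsProbabilityMeasure κ] (k : ℕ),
      Integrable (fun x => min (Real.exp (-α * x)) (k : ℝ)) κ := by
    intro κ _ k
    refine Integrable.of_bound (C := (k : ℝ)) (by fun_prop) (Eventually.of_forall fun x => ?_)
    rw [Real.norm_of_nonneg (le_min (Real.exp_pos _).le (Nat.cast_nonneg k))]
    exact min_le_right _ _
  have hlim : ∀ k : ℕ, Tendsto (fun n => ∫ x, min (Real.exp (-α * x)) (k : ℝ) ∂(μs n : Measure ℝ)) l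
      (𝓝 (∫ x, min (Real.exp (-α * x)) (k : ℝ) ∂(ρ : Measure ℝ))) := by
    intro k
    refine hρ (BoundedContinuousFunction.ofNormedAddCommGroup
      (fun x => min (Real.exp (-α * x)) (k : ℝ)) (by fun_prop) k fun x => ?_)
    rw [Real.norm_of_nonneg (le_min (Real.exp_pos _).le (Nat.cast_nonneg k))]
    exact min_le_right _ _
  have hub : ∀ k : ℕ, ∫ x, min (Real.exp (-α * x)) (k : ℝ) ∂(ρ : Measure ℝ) ≤ M α := fun k =>
    le_of_tendsto_of_tendsto' (hlim k) (hM α hα) fun n =>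
      integral_mono (hmin_int _ k) (hint n α hα) fun x => min_le_left _ _
  -- Uniform integrability: `y - y^2 / k ≤ min y k`, and the square of `y = exp (-α x)` is
  -- controlled by the transform at `2α`.
  have hlb : ∀ k : ℕ, 0 < k → M α - M (2 * α) / k
      ≤ ∫ x, min (Real.exp (-α * x)) (k : ℝ) ∂(ρ : Measure ℝ) := by
    intro k hk
    have hk' : (0 : ℝ) < k := by exact_mod_cast hk
    refine le_of_tendsto_of_tendsto' ((hM α hα).sub ((hM (2 * α) (by positivity)).div_const (k : ℝ)))
      (hlim k) fun n => ?_
    rw [← integral_div, ← integral_sub (hint n α hα) ((hint n (2 * α) (by positivity)).div_const _)]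
    refine integral_mono ((hint n α hα).sub ((hint n (2 * α) (by positivity)).div_const _))
      (hmin_int _ k) fun x => ?_
    have h2 : Real.exp (-(2 * α) * x) = Real.exp (-α * x) * Real.exp (-α * x) := by
      rw [← Real.exp_add]; ring_nf
    have hp := Real.exp_pos (-α * x)
    simp only [h2]
    refine le_min ?_ ?_
    · have : 0 ≤ Real.exp (-α * x) * Real.exp (-α * x) / k := by positivity
      linarith
    · rw [sub_le_iff_le_add, ← sub_nonneg]
      have : (k : ℝ) + Real.exp (-α * x) * Real.exp (-α * x) / k - Real.exp (-α * x)
          = ((Real.exp (-α * x) - k / 2) ^ 2 + 3 / 4 * (k : ℝ) ^ 2) / k := by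
        field_simp; ring
      rw [this]; positivity
  have hmono : Tendsto (fun k : ℕ => ∫ x, min (Real.exp (-α * x)) (k : ℝ) ∂(ρ : Measure ℝ)) atTop
      (𝓝 (M α)) := by
    refine tendsto_of_tendsto_of_tendsto_of_le_of_le' (g := fun k : ℕ => M α - M (2 * α) / k) ?_
      tendsto_const_nhds ?_ (Eventually.of_forall hub)
    · simpa using (tendsto_const_div_atTop_nhds_zero_nat (M (2 * α))).const_sub (M α)
    · filter_upwards [eventually_gt_atTop 0] with k hk using hlb k hk
  have hpt : ∀ x : ℝ, Tendsto (fun k : ℕ => min (Real.exp (-α * x)) (k : ℝ)) atTop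
      (𝓝 (Real.exp (-α * x))) := by
    intro x
    refine tendsto_const_nhds.congr' ?_
    filter_upwards [eventually_ge_atTop ⌈Real.exp (-α * x)⌉₊] with k hk
    exact (min_eq_left ((Nat.le_ceil _).trans (by exact_mod_cast hk))).symm
  have hI : Integrable (fun x => Real.exp (-α * x)) (ρ : Measure ℝ) := by
    refine integrable_of_tendsto (G := fun (k : ℕ) x => min (Real.exp (-α * x)) (k : ℝ))
      (Eventually.of_forall hpt) (fun k => by fun_prop) ?_
    refine ne_top_of_le_ne_top (ENNReal.ofReal_ne_top (r := M α))
      (liminf_le_of_frequently_le' (Eventually.of_forall fun k => ?_).frequently)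
    rw [← ofReal_integral_norm_eq_lintegral_enorm (hmin_int _ k)]
    refine ENNReal.ofReal_le_ofReal ((integral_congr_ae (Eventually.of_forall fun x => ?_)).trans_le
      (hub k))
    exact Real.norm_of_nonneg (le_min (Real.exp_pos _).le (Nat.cast_nonneg k))
  refine ⟨hI, tendsto_nhds_unique ?_ hmono⟩
  exact integral_tendsto_of_tendsto_of_monotone (fun k => hmin_int _ k) hI
    (Eventually.of_forall fun x i j hij => min_le_min_left _ (by exact_mod_cast hij))
    (Eventually.of_forall hpt)

/-- Convergence in law on `ℝ` from convergence of the Laplace transforms on `(0, ∞)`. -/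
theorem exists_tendsto_of_tendsto_laplace (μs : ℕ → ProbabilityMeasure ℝ) (M : ℝ → ℝ)
    (hint : ∀ n, ∀ α : ℝ, 0 < α → Integrable (fun x => Real.exp (-α * x)) (μs n : Measure ℝ))
    (hM : ∀ α : ℝ, 0 < α →
      Tendsto (fun n => ∫ x, Real.exp (-α * x) ∂(μs n : Measure ℝ)) atTop (𝓝 (M α)))
    (hM0 : Tendsto M (𝓝[>] 0) (𝓝 1)) :
    ∃ ρ : ProbabilityMeasure ℝ, Tendsto μs atTop (𝓝 ρ) ∧ ∀ α : ℝ, 0 < α →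
      Integrable (fun x => Real.exp (-α * x)) (ρ : Measure ℝ) ∧
      ∫ x, Real.exp (-α * x) ∂(ρ : Measure ℝ) = M α := by
  have htight := isTightMeasureSet_range_of_tendsto_laplace μs M hint hM hM0
  have hK : IsCompact (closure (Set.range μs)) := by
    refine isCompact_closure_of_isTightMeasureSet (htight.subset ?_)
    rintro _ ⟨_, ⟨n, rfl⟩, rfl⟩
    exact Set.mem_range_self n
  have hcl : ∀ ρ, MapClusterPt ρ atTop μs → ∀ α : ℝ, 0 < α →
      Integrable (fun x => Real.exp (-α * x)) (ρ : Measure ℝ) ∧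
      ∫ x, Real.exp (-α * x) ∂(ρ : Measure ℝ) = M α := by
    intro ρ hρ α hα
    -- Cluster points are limits along ultrafilters finer than `atTop`; this is why
    -- `integral_exp_neg_mul_of_tendsto` allows a general filter.
    obtain ⟨U, hU, hUρ⟩ := mapClusterPt_iff_ultrafilter.1 hρ
    exact integral_exp_neg_mul_of_tendsto (l := (U : Filter ℕ)) μs M ρ hint
      (fun α hα => (hM α hα).mono_left hU) hUρ hα
  obtain ⟨ρ, hρmem, hρ⟩ := hK.exists_mapClusterPt (f := atTop) (u := μs)
    (tendsto_principal.2 (Eventually.of_forall fun n => subset_closure (Set.mem_range_self n)))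
  refine ⟨ρ, hK.tendsto_nhds_of_unique_mapClusterPt
    (Eventually.of_forall fun n => subset_closure (Set.mem_range_self n)) fun κ _ hκ => ?_, hcl ρ hρ⟩
  refine Subtype.ext (ext_of_integral_exp_neg_mul_eq (μ := (κ : Measure ℝ))
    (ρ := (ρ : Measure ℝ)) (fun α hα => (hcl κ hκ α hα).1)
    (fun α hα => (hcl ρ hρ α hα).1) fun α hα => ?_)
  rw [(hcl κ hκ α hα).2, (hcl ρ hρ α hα).2]

/-! ### Markov jump processes: optional stopping on a time grid. -/

/-- First order expansion at `0` of the semigroup `t ↦ exp (-α t) exp (t Q)`. -/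
theorem Matrix.tendsto_exp_smul_mulVec_div {S : Type*} [Fintype S] [DecidableEq S]
    (Q : Matrix S S ℝ) (f : S → ℝ) (α : ℝ) (x : S) :
    Tendsto (fun h : ℝ => (Real.exp (-α * h) * (NormedSpace.exp (h • Q)).mulVec f x - f x) / h)
      (𝓝[≠] 0) (𝓝 (Q.mulVec f x - α * f x)) := by
  let _ : NormedRing (Matrix S S ℝ) := Matrix.linftyOpNormedRing
  let _ : NormedAlgebra ℝ (Matrix S S ℝ) := Matrix.linftyOpNormedAlgebra
  let φ : Matrix S S ℝ →ₗ[ℝ] ℝ :=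
    { toFun := fun A => A.mulVec f x
      map_add' := fun A B => by simp [Matrix.add_mulVec]
      map_smul' := fun r A => by simp [Matrix.smul_mulVec] }
  have h1 := hasDerivAt_exp_smul_const (𝕂 := ℝ) Q (0 : ℝ)
  have h2 := φ.toContinuousLinearMap.hasFDerivAt.comp_hasDerivAt (0 : ℝ) h1
  have h3 : HasDerivAt (fun h : ℝ => Real.exp (-α * h)) (-α) 0 := by
    have := ((hasDerivAt_id (0 : ℝ)).const_mul (-α)).exp
    simpa using this
  have h2' : HasDerivAt (fun u : ℝ => (NormedSpace.exp (u • Q)).mulVec f x)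
      ((NormedSpace.exp ((0 : ℝ) • Q) * Q).mulVec f x) 0 := h2
  rw [zero_smul, NormedSpace.exp_zero, one_mul] at h2'
  have h4 := hasDerivAt_iff_tendsto_slope.1 (h3.mul h2')
  have e1 : -α * (NormedSpace.exp ((0 : ℝ) • Q)).mulVec f x + Real.exp (-α * 0) * Q.mulVec f x
      = Q.mulVec f x - α * f x := by
    rw [zero_smul, NormedSpace.exp_zero, Matrix.one_mulVec, mul_zero, Real.exp_zero]; ring
  rw [e1] at h4
  refine h4.congr fun h => ?_
  simp [slope_def_field]

section MarkovChain

variable {S Ω : Type*} [Fintype S] [DecidableEq S] [MeasurableSpace Ω]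
  {Q : Matrix S S ℝ} {x₀ : S} {X : ℝ≥0 → Ω → S} {P : Measure Ω}

namespace IsMarkovJumpProcess

theorem measurableSet_path (hX : IsMarkovJumpProcess Q x₀ X P) (t : ℕ → ℝ≥0) (n : ℕ)
    (p : ℕ → S) : MeasurableSet {ω | ∀ i ≤ n, X (t i) ω = p i} := by
  have h : {ω | ∀ i ≤ n, X (t i) ω = p i} = ⋂ i, ⋂ _ : i ≤ n, {ω | X (t i) ω = p i} := by
    ext ω; simp
  rw [h]
  exact MeasurableSet.iInter fun i => MeasurableSet.iInter fun _ => hX.measurableSet_eq _ _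

theorem measurableSet_firstHit (hX : IsMarkovJumpProcess Q x₀ X P) (c : S) (t : ℕ → ℝ≥0) (n : ℕ)
    (x : S) : MeasurableSet {ω | (∀ i < n, X (t i) ω ≠ c) ∧ X (t n) ω = x} := by
  have h : {ω | (∀ i < n, X (t i) ω ≠ c) ∧ X (t n) ω = x}
      = (⋂ i, ⋂ _ : i < n, {ω | X (t i) ω = c}ᶜ) ∩ {ω | X (t n) ω = x} := by
    ext ω; simp
  rw [h]
  exact (MeasurableSet.iInter fun i => MeasurableSet.iInter fun _ =>
    (hX.measurableSet_eq _ _).compl).inter (hX.measurableSet_eq _ _)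

/-- The Markov property on the event that `c` has not been visited at the earlier times. -/
theorem measureReal_avoid [IsFiniteMeasure P] (hX : IsMarkovJumpProcess Q x₀ X P) (c : S)
    (t : ℕ → ℝ≥0) (ht : Monotone t) (n : ℕ) (x y : S) :
    P.real {ω | ((∀ i < n, X (t i) ω ≠ c) ∧ X (t n) ω = x) ∧ X (t (n + 1)) ω = y} =
      P.real {ω | (∀ i < n, X (t i) ω ≠ c) ∧ X (t n) ω = x} *
        NormedSpace.exp (((t (n + 1) : ℝ) - (t n : ℝ)) • Q) x y := by
  classical
  -- `F` lists the paths on times `0, …, n` that avoid `c` before `n` and end at `x`. Extending them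
  -- by `y` makes them `ℕ`-indexed, as the field `markov` requires.
  let ext : (Fin (n + 1) → S) → ℕ → S := fun p i => if h : i < n + 1 then p ⟨i, h⟩ else y
  let F : Finset (Fin (n + 1) → S) :=
    Finset.univ.filter fun p => (∀ i : Fin (n + 1), (i : ℕ) < n → p i ≠ c) ∧ p (Fin.last n) = x
  have hext : ∀ p (i : ℕ) (h : i < n + 1), ext p i = p ⟨i, h⟩ := fun p i h => dif_pos h
  have hext' : ∀ p, ext p (n + 1) = y := fun p => dif_neg (lt_irrefl _)
  have hA : {ω | (∀ i < n, X (t i) ω ≠ c) ∧ X (t n) ω = x}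
      = ⋃ p ∈ F, {ω | ∀ i ≤ n, X (t i) ω = ext p i} := by
    ext ω
    simp only [Set.mem_iUnion, Set.mem_ofPred_eq, exists_prop, F, Finset.mem_filter,
      Finset.mem_univ, true_and]
    constructor
    · rintro ⟨h1, h2⟩
      exact ⟨fun i => X (t i) ω, ⟨fun i hi => h1 i hi, h2⟩,
        fun i hi => (hext (fun j => X (t j) ω) i (Nat.lt_succ_of_le hi)).symm⟩
    · rintro ⟨p, ⟨h1, h2⟩, h3⟩
      refine ⟨fun i hi => ?_, ?_⟩
      · rw [h3 i hi.le, hext p i (by omega)]; exact h1 _ hi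
      · rw [h3 n le_rfl, hext p n (by omega)]; exact h2
  have hB : {ω | ((∀ i < n, X (t i) ω ≠ c) ∧ X (t n) ω = x) ∧ X (t (n + 1)) ω = y}
      = ⋃ p ∈ F, {ω | ∀ i ≤ n + 1, X (t i) ω = ext p i} := by
    ext ω
    have h := Set.ext_iff.1 hA ω
    simp only [Set.mem_iUnion, Set.mem_ofPred_eq, exists_prop] at h ⊢
    rw [h]
    constructor
    · rintro ⟨⟨p, hp, h1⟩, h2⟩
      refine ⟨p, hp, fun i hi => ?_⟩
      rcases Nat.le_succ_iff.1 hi with hi | rfl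
      · exact h1 i hi
      · rw [hext', h2]
    · rintro ⟨p, hp, h1⟩
      exact ⟨⟨p, hp, fun i hi => h1 i (by omega)⟩, by rw [h1 (n + 1) le_rfl, hext']⟩
  have hdis : ∀ m, n ≤ m → Set.PairwiseDisjoint (F : Set (Fin (n + 1) → S))
      fun p => {ω | ∀ i ≤ m, X (t i) ω = ext p i} := by
    intro m hm p _ q _ hpq
    refine Set.disjoint_left.2 fun ω h1 h2 => hpq (funext fun i => ?_)
    have hi : (i : ℕ) ≤ m := by omega
    have := (h1 i hi).symm.trans (h2 i hi)
    rwa [hext p i i.2, hext q i i.2] at this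
  rw [hA, hB, measureReal_biUnion_finset (hdis _ (Nat.le_succ n))
    (fun p _ => hX.measurableSet_path t (n + 1) (ext p)),
    measureReal_biUnion_finset (hdis _ le_rfl) (fun p _ => hX.measurableSet_path t n (ext p)),
    Finset.sum_mul]
  refine Finset.sum_congr rfl fun p hp => ?_
  rw [hX.markov n t (ext p) ht, hext' p, hext p n (by omega)]
  simp only [F, Finset.mem_filter, Finset.mem_univ, true_and] at hp
  rw [show (⟨n, by omega⟩ : Fin (n + 1)) = Fin.last n from rfl, hp.2]

/-- One step of the law of the chain killed at `c`. -/
theorem measureReal_firstHit_succ [IsFiniteMeasure P] (hX : IsMarkovJumpProcess Q x₀ X P) (c : S)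
    (t : ℕ → ℝ≥0) (ht : Monotone t) (n : ℕ) (y : S) :
    P.real {ω | (∀ i < n + 1, X (t i) ω ≠ c) ∧ X (t (n + 1)) ω = y} =
      ∑ x ∈ Finset.univ.erase c, P.real {ω | (∀ i < n, X (t i) ω ≠ c) ∧ X (t n) ω = x} *
        NormedSpace.exp (((t (n + 1) : ℝ) - (t n : ℝ)) • Q) x y := by
  have hset : {ω | (∀ i < n + 1, X (t i) ω ≠ c) ∧ X (t (n + 1)) ω = y}
      = ⋃ x ∈ Finset.univ.erase c,
        {ω | ((∀ i < n, X (t i) ω ≠ c) ∧ X (t n) ω = x) ∧ X (t (n + 1)) ω = y} := by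
    ext ω
    simp only [Set.mem_iUnion, Set.mem_ofPred_eq, exists_prop, Finset.mem_erase, Finset.mem_univ,
      and_true]
    constructor
    · rintro ⟨h1, h2⟩
      exact ⟨X (t n) ω, h1 n (by omega), ⟨fun i hi => h1 i (by omega), rfl⟩, h2⟩
    · rintro ⟨x, hx, ⟨h1, h2⟩, h3⟩
      refine ⟨fun i hi => ?_, h3⟩
      rcases Nat.lt_succ_iff_lt_or_eq.1 hi with hi | rfl
      · exact h1 i hi
      · rwa [h2]
  rw [hset, measureReal_biUnion_finset]
  · exact Finset.sum_congr rfl fun x _ => hX.measureReal_avoid c t ht n x y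
  · intro x _ y _ hxy
    exact Set.disjoint_left.2 fun ω h1 h2 => hxy (h1.1.2.symm.trans h2.1.2)
  · exact fun x _ => (hX.measurableSet_firstHit c t n x).inter (hX.measurableSet_eq _ _)

theorem sum_measureReal_firstHit_le [IsProbabilityMeasure P] (hX : IsMarkovJumpProcess Q x₀ X P)
    (c : S) (t : ℕ → ℝ≥0) (n : ℕ) (s : Finset S) :
    ∑ x ∈ s, P.real {ω | (∀ i < n, X (t i) ω ≠ c) ∧ X (t n) ω = x} ≤ 1 := by
  rw [← measureReal_biUnion_finset]
  · exact measureReal_le_one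
  · intro x _ y _ hxy
    exact Set.disjoint_left.2 fun ω h1 h2 => hxy (h1.2.symm.trans h2.2)
  · exact fun x _ => hX.measurableSet_firstHit c t n x

/-- Approximate optional stopping on the grid of mesh `h`. -/
theorem abs_sum_firstHit_sub_le [IsProbabilityMeasure P] (hX : IsMarkovJumpProcess Q x₀ X P) (c : S)
    (f : S → ℝ) {α η B : ℝ} (hα : 0 < α) (h : ℝ≥0) (hh : 0 < h) (hη0 : 0 ≤ η)
    (hη : ∀ x, x ≠ c →
      |Real.exp (-α * h) * (NormedSpace.exp ((h : ℝ) • Q)).mulVec f x - f x| ≤ η * h)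
    (hB : ∀ x, |f x| ≤ B) (n : ℕ) :
    |f c * (∑ k ∈ Finset.range n, Real.exp (-α * (k * h)) *
        P.real {ω | (∀ i < k, X (i * h) ω ≠ c) ∧ X (k * h) ω = c}) - f x₀|
      ≤ η * ((1 + α * h) / α) + Real.exp (-α * (n * h)) * B := by
  set t : ℕ → ℝ≥0 := fun i => i * h with ht_def
  have ht : Monotone t := fun i j hij => mul_le_mul_left (by exact_mod_cast hij) _
  have htd : ∀ n, (t (n + 1) : ℝ) - t n = h := by
    intro n; simp only [ht_def]; push_cast; ring
  set w : ℕ → S → ℝ := fun k x => P.real {ω | (∀ i < k, X (t i) ω ≠ c) ∧ X (t k) ω = x} with hw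
  set E := NormedSpace.exp ((h : ℝ) • Q) with hE
  have hw0 : ∀ k x, 0 ≤ w k x := fun k x => measureReal_nonneg
  have hsucc : ∀ k y, w (k + 1) y = ∑ x ∈ Finset.univ.erase c, w k x * E x y := by
    intro k y
    have := hX.measureReal_firstHit_succ c t ht k y
    rwa [htd k] at this
  -- `a k` is the discounted mean of `f` on the event of no visit to `c` before step `k`. Mass
  -- sitting at `c` at step `k` is still counted in `a k` and dropped from `a (k + 1)`.
  set a : ℕ → ℝ := fun k => Real.exp (-α * (k * h)) * ∑ x, w k x * f x with ha
  have ha0 : a 0 = f x₀ := by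
    have hw00 : ∀ x, w 0 x = if x = x₀ then 1 else 0 := by
      intro x
      have hset : {ω | (∀ i < 0, X (t i) ω ≠ c) ∧ X (t 0) ω = x} = {ω | X 0 ω = x} := by
        ext ω; simp [ht_def]
      simp only [hw, hset]
      split_ifs with hx
      · rw [hx, measureReal_congr (t := Set.univ) (eventuallyEq_univ.2 hX.initial)]
        simp
      · rw [measureReal_congr (t := ∅), measureReal_empty]
        refine eventuallyEq_empty.2 ?_
        filter_upwards [hX.initial] with ω hω h
        exact hx (h.symm.trans hω)
    simp [ha, hw00]
  -- After compensation for the mass absorbed at `c`, one step changes `a` only by the local error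
  -- `η h`, discounted; summing telescopes.
  have hstep : ∀ k, |a (k + 1) - a k + f c * (Real.exp (-α * (k * h)) * w k c)|
      ≤ η * h * Real.exp (-α * h) ^ k := by
    intro k
    have hpow : Real.exp (-α * h) ^ k = Real.exp (-α * (k * h)) := by
      rw [← Real.exp_nat_mul]; ring_nf
    have e1 : a (k + 1) = Real.exp (-α * (k * h)) *
        ∑ x ∈ Finset.univ.erase c, w k x * (Real.exp (-α * h) * E.mulVec f x) := by
      simp only [ha, hsucc]
      have : Real.exp (-α * ((k + 1 : ℕ) * h)) = Real.exp (-α * (k * h)) * Real.exp (-α * h) := by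
        rw [← Real.exp_add]; push_cast; ring_nf
      rw [this, mul_assoc]
      congr 1
      simp only [Finset.sum_mul, Matrix.mulVec, dotProduct, Finset.mul_sum]
      rw [Finset.sum_comm]
      refine Finset.sum_congr rfl fun x _ => Finset.sum_congr rfl fun y _ => by ring
    have e2 : a k = Real.exp (-α * (k * h)) *
        (w k c * f c + ∑ x ∈ Finset.univ.erase c, w k x * f x) := by
      simp only [ha]
      rw [Finset.add_sum_erase Finset.univ (fun x => w k x * f x) (Finset.mem_univ c)]
    have e3 : a (k + 1) - a k + f c * (Real.exp (-α * (k * h)) * w k c)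
        = Real.exp (-α * (k * h)) *
          ∑ x ∈ Finset.univ.erase c, w k x * (Real.exp (-α * h) * E.mulVec f x - f x) := by
      rw [e1, e2]
      simp only [mul_sub, Finset.sum_sub_distrib]
      ring
    rw [e3, abs_mul, abs_of_pos (Real.exp_pos _), hpow, mul_comm]
    refine mul_le_mul_of_nonneg_right ?_ (Real.exp_pos _).le
    refine (Finset.abs_sum_le_sum_abs _ _).trans ?_
    calc ∑ x ∈ Finset.univ.erase c, |w k x * (Real.exp (-α * h) * E.mulVec f x - f x)|
        ≤ ∑ x ∈ Finset.univ.erase c, w k x * (η * h) := by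
          refine Finset.sum_le_sum fun x hx => ?_
          rw [abs_mul, abs_of_nonneg (hw0 k x)]
          exact mul_le_mul_of_nonneg_left (hη x (Finset.ne_of_mem_erase hx)) (hw0 k x)
      _ = (∑ x ∈ Finset.univ.erase c, w k x) * (η * h) := by rw [Finset.sum_mul]
      _ ≤ 1 * (η * h) := by
          refine mul_le_mul_of_nonneg_right (hX.sum_measureReal_firstHit_le c t k _) ?_
          positivity
      _ = η * h := one_mul _
  have htel : f c * (∑ k ∈ Finset.range n, Real.exp (-α * (k * h)) * w k c) - f x₀
      = ∑ k ∈ Finset.range n, (a (k + 1) - a k + f c * (Real.exp (-α * (k * h)) * w k c)) - a n := by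
    rw [Finset.sum_add_distrib, Finset.sum_range_sub, ha0, Finset.mul_sum]; ring
  have hgeom : ∑ k ∈ Finset.range n, η * h * Real.exp (-α * h) ^ k ≤ η * ((1 + α * h) / α) := by
    have hh' : (0 : ℝ) < h := by exact_mod_cast hh
    have hr1 : Real.exp (-α * h) < 1 := by rw [Real.exp_lt_one_iff]; nlinarith
    rw [← Finset.mul_sum, mul_assoc]
    refine mul_le_mul_of_nonneg_left ?_ hη0
    have hs : ∑ k ∈ Finset.range n, Real.exp (-α * h) ^ k ≤ (1 - Real.exp (-α * h))⁻¹ :=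
      (summable_geometric_of_lt_one (Real.exp_pos _).le hr1).sum_le_tsum _
        (fun i _ => by positivity) |>.trans_eq
        (tsum_geometric_of_lt_one (Real.exp_pos _).le hr1)
    -- This bounds `h` times the geometric sum by `(1 + α h) / α`, which stays bounded as `h → 0`.
    have hexp : Real.exp (-α * h) ≤ (1 + α * h)⁻¹ := by
      rw [neg_mul, Real.exp_neg]
      refine inv_anti₀ (by positivity) ?_
      linarith [Real.add_one_le_exp (α * h)]
    have hinv : (1 - Real.exp (-α * h))⁻¹ ≤ (α * h / (1 + α * h))⁻¹ := by
      refine inv_anti₀ (by positivity) ?_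
      have : α * h / (1 + α * h) = 1 - (1 + α * h)⁻¹ := by field_simp; ring
      rw [this]; linarith
    calc (h : ℝ) * ∑ k ∈ Finset.range n, Real.exp (-α * h) ^ k
        ≤ h * (α * h / (1 + α * h))⁻¹ := mul_le_mul_of_nonneg_left (hs.trans hinv) hh'.le
      _ = (1 + α * h) / α := by field_simp
  have hlast : |a n| ≤ Real.exp (-α * (n * h)) * B := by
    simp only [ha]
    rw [abs_mul, abs_of_pos (Real.exp_pos _)]
    refine mul_le_mul_of_nonneg_left ?_ (Real.exp_pos _).le
    have hB0 : 0 ≤ B := (abs_nonneg _).trans (hB c)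
    calc |∑ x, w n x * f x| ≤ ∑ x, |w n x * f x| := Finset.abs_sum_le_sum_abs _ _
      _ ≤ ∑ x, w n x * B := by
          refine Finset.sum_le_sum fun x _ => ?_
          rw [abs_mul, abs_of_nonneg (hw0 n x)]
          exact mul_le_mul_of_nonneg_left (hB x) (hw0 n x)
      _ = (∑ x, w n x) * B := by rw [Finset.sum_mul]
      _ ≤ 1 * B := mul_le_mul_of_nonneg_right (hX.sum_measureReal_firstHit_le c t n _) hB0
      _ = B := one_mul _
  have : f c * (∑ k ∈ Finset.range n, Real.exp (-α * (k * h)) * w k c) - f x₀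
      = f c * (∑ k ∈ Finset.range n, Real.exp (-α * (k * h)) *
        P.real {ω | (∀ i < k, X (i * h) ω ≠ c) ∧ X (k * h) ω = c}) - f x₀ := rfl
  rw [← this, htel]
  refine (abs_sub _ _).trans (add_le_add ?_ hlast)
  exact (Finset.abs_sum_le_sum_abs _ _).trans ((Finset.sum_le_sum fun k _ => hstep k).trans hgeom)

end IsMarkovJumpProcess

end MarkovChain

/-! ### Discounted hitting times as limits along dyadic grids. -/

/-- `exp (-α T)` for the hitting time `T` of `c`, with value `0` where `T = ⊤`. -/
noncomputable def discountedHitting {S Ω : Type*} (X : ℝ≥0 → Ω → S) (c : S) (α : ℝ) (ω : Ω) : ℝ :=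
  open Classical in
  if hittingAfter X {c} 0 ω = ⊤ then 0
  else Real.exp (-α * (((hittingAfter X {c} 0 ω).untopD 0 : ℝ≥0) : ℝ))

/-- The discounted hitting time of `c` on the grid of mesh `2 ^ (-m)`, up to time `2 ^ m`. -/
noncomputable def gridDiscountedHitting {S Ω : Type*} (X : ℝ≥0 → Ω → S) (c : S) (α : ℝ) (m : ℕ)
    (ω : Ω) : ℝ :=
  ∑ k ∈ Finset.range (4 ^ m), Real.exp (-α * (k * ((2 ^ m)⁻¹ : ℝ≥0))) *
    Set.indicator {ω | (∀ i < k, X ((i : ℝ≥0) * (2 ^ m)⁻¹) ω ≠ c) ∧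
      X ((k : ℝ≥0) * (2 ^ m)⁻¹) ω = c} 1 ω

/-- The infimum is a limit of hitting instants to its right or equal to it, and right-continuity in
the discrete space makes the path constant just after it; hence the infimum is attained. -/
theorem exists_isLeast_of_rightContinuous {S Ω : Type*} {X : ℝ≥0 → Ω → S} {c : S} {ω : Ω}
    (hrc : ∀ t : ℝ≥0, ∀ᶠ s in 𝓝[≥] t, X s ω = X t ω) (hT : hittingAfter X {c} 0 ω ≠ ⊤) :
    ∃ T : ℝ≥0, hittingAfter X {c} 0 ω = T ∧ X T ω = c ∧ ∀ s < T, X s ω ≠ c := by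
  classical
  have hex : ∃ j, (0 : ℝ≥0) ≤ j ∧ X j ω ∈ ({c} : Set S) := by
    by_contra h
    exact hT (by simp only [hittingAfter, if_neg h])
  set A : Set ℝ≥0 := {i | 0 ≤ i ∧ X i ω ∈ ({c} : Set S)} with hA
  have hne : A.Nonempty := hex
  have hbdd : BddBelow A := OrderBot.bddBelow A
  refine ⟨sInf A, by simp only [hittingAfter, if_pos hex]; rfl, ?_, fun s hs h => ?_⟩
  · have h1 := hrc (sInf A)
    rw [eventually_nhdsWithin_iff] at h1
    have h2 := mem_closure_iff_frequently.1 (csInf_mem_closure hne hbdd)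
    obtain ⟨s, hsA, hs⟩ := (h2.and_eventually h1).exists
    rw [← hs (csInf_le hbdd hsA)]
    exact hsA.2
  · exact absurd (csInf_le hbdd (show s ∈ A from ⟨zero_le, h⟩)) (not_le.2 hs)

/-- By right-continuity the path stays at `c` on some `[T, T + ε)`. Once the mesh is below `ε`, the
first grid point at or after `T` is the first grid visit to `c`, and it converges to `T`. -/
theorem tendsto_gridDiscountedHitting {S Ω : Type*} {X : ℝ≥0 → Ω → S} {c : S} {ω : Ω}
    (hrc : ∀ t : ℝ≥0, ∀ᶠ s in 𝓝[≥] t, X s ω = X t ω) (α : ℝ) :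
    Tendsto (fun m => gridDiscountedHitting X c α m ω) atTop (𝓝 (discountedHitting X c α ω)) := by
  classical
  have hpow : Tendsto (fun m : ℕ => (((2 ^ m)⁻¹ : ℝ≥0) : ℝ)) atTop (𝓝 0) := by
    have := tendsto_pow_atTop_nhds_zero_of_lt_one (r := (1 / 2 : ℝ)) (by norm_num) (by norm_num)
    refine this.congr fun m => ?_
    push_cast
    rw [one_div, inv_pow]
  by_cases hT : hittingAfter X {c} 0 ω = ⊤
  · have hno : ∀ t : ℝ≥0, X t ω ≠ c := by
      intro t ht
      have hex : ∃ j, (0 : ℝ≥0) ≤ j ∧ X j ω ∈ ({c} : Set S) := ⟨t, zero_le, ht⟩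
      simp only [hittingAfter, if_pos hex] at hT
      exact WithTop.coe_ne_top hT
    rw [discountedHitting, if_pos hT]
    refine tendsto_const_nhds.congr fun m => ?_
    refine (Finset.sum_eq_zero fun k _ => ?_).symm
    rw [Set.indicator_of_notMem (fun h => hno _ h.2), mul_zero]
  · obtain ⟨T, hTe, hTc, hTlt⟩ := exists_isLeast_of_rightContinuous hrc hT
    rw [discountedHitting, if_neg hT, hTe, WithTop.untopD_coe]
    obtain ⟨ε, hε, hεT⟩ : ∃ ε : ℝ, 0 < ε ∧ ∀ s : ℝ≥0, T ≤ s → (s : ℝ) < T + ε → X s ω = c := by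
      have h1 := hrc T
      rw [eventually_nhdsWithin_iff, Metric.eventually_nhds_iff] at h1
      obtain ⟨ε, hε, h⟩ := h1
      refine ⟨ε, hε, fun s hs hsε => ?_⟩
      rw [h _ hs, hTc]
      rw [NNReal.dist_eq, abs_of_nonneg (sub_nonneg.2 (NNReal.coe_le_coe.2 hs))]
      linarith
    have hk : ∀ m : ℕ, (T : ℝ) ≤ ⌈T * 2 ^ m⌉₊ * ((2 ^ m)⁻¹ : ℝ≥0) ∧
        (⌈T * 2 ^ m⌉₊ * ((2 ^ m)⁻¹ : ℝ≥0) : ℝ) < T + ((2 ^ m)⁻¹ : ℝ≥0) := by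
      intro m
      have hp : (0 : ℝ) < 2 ^ m := by positivity
      have h1 : ((T * 2 ^ m : ℝ≥0) : ℝ) ≤ ⌈T * 2 ^ m⌉₊ := by exact_mod_cast Nat.le_ceil (T * 2 ^ m)
      have h2 : (⌈T * 2 ^ m⌉₊ : ℝ) < ((T * 2 ^ m : ℝ≥0) : ℝ) + 1 := by
        exact_mod_cast Nat.ceil_lt_add_one (a := T * 2 ^ m) zero_le
      push_cast at h1 h2 ⊢
      rw [← div_eq_mul_inv, le_div_iff₀ hp, div_lt_iff₀ hp, add_mul, inv_mul_cancel₀ hp.ne']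
      exact ⟨h1, h2⟩
    have hval : ∀ᶠ m : ℕ in atTop, gridDiscountedHitting X c α m ω
        = Real.exp (-α * (⌈T * 2 ^ m⌉₊ * ((2 ^ m)⁻¹ : ℝ≥0))) := by
      -- This places the index `⌈T 2^m⌉ < T 2^m + 1` below `4^m`, the number of grid points summed
      -- over.
      have hbig : ∀ᶠ m : ℕ in atTop, (T : ℝ) + 1 ≤ 2 ^ m :=
        (tendsto_pow_atTop_atTop_of_one_lt (by norm_num)).eventually_ge_atTop _
      filter_upwards [hpow.eventually_lt_const hε, hbig] with m hm hm2
      have hp : (0 : ℝ≥0) < (2 ^ m)⁻¹ := by positivity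
      have hfirst : ω ∈ {ω | (∀ i < ⌈T * 2 ^ m⌉₊, X ((i : ℝ≥0) * (2 ^ m)⁻¹) ω ≠ c) ∧
          X ((⌈T * 2 ^ m⌉₊ : ℝ≥0) * (2 ^ m)⁻¹) ω = c} := by
        refine ⟨fun i hi => hTlt _ ?_, hεT _ ?_ ?_⟩
        · rw [Nat.lt_ceil] at hi
          rwa [← div_eq_mul_inv, div_lt_iff₀ (by positivity)]
        · exact_mod_cast (hk m).1
        · push_cast
          have := (hk m).2
          push_cast at this hm
          linarith
      rw [gridDiscountedHitting, Finset.sum_eq_single ⌈T * 2 ^ m⌉₊]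
      · rw [Set.indicator_of_mem hfirst, Pi.one_apply, mul_one]
      · intro k _ hk'
        rw [Set.indicator_of_notMem, mul_zero]
        rintro ⟨h1, h2⟩
        rcases lt_trichotomy k ⌈T * 2 ^ m⌉₊ with hlt | heq | hgt
        · exact hfirst.1 k hlt h2
        · exact hk' heq
        · exact h1 _ hgt hfirst.2
      · intro hmem
        refine absurd (Finset.mem_range.2 ?_) hmem
        have h2 : (⌈T * 2 ^ m⌉₊ : ℝ) < ((T * 2 ^ m : ℝ≥0) : ℝ) + 1 := by
          exact_mod_cast Nat.ceil_lt_add_one (a := T * 2 ^ m) zero_le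
        push_cast at h2
        have h1 : (1 : ℝ) ≤ 2 ^ m := one_le_pow₀ (by norm_num)
        have h4 : ((4 ^ m : ℕ) : ℝ) = 2 ^ m * 2 ^ m := by
          push_cast; rw [← mul_pow]; norm_num
        have : (⌈T * 2 ^ m⌉₊ : ℝ) < ((4 ^ m : ℕ) : ℝ) := by
          rw [h4]; nlinarith
        exact_mod_cast this
    refine Tendsto.congr' (hval.mono fun m hm => hm.symm) ?_
    refine (Real.continuous_exp.tendsto _).comp (Tendsto.const_mul _ ?_)
    refine tendsto_of_tendsto_of_tendsto_of_le_of_le (g := fun _ => (T : ℝ))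
      (h := fun m => (T : ℝ) + ((2 ^ m)⁻¹ : ℝ≥0)) tendsto_const_nhds ?_ (fun m => (hk m).1)
      (fun m => (hk m).2.le)
    simpa using hpow.const_add (T : ℝ)

/-- First-visit events at different indices are disjoint, so at most one term of the sum is nonzero.
This is the uniform bound for dominated convergence. -/
theorem gridDiscountedHitting_mem_Icc {S Ω : Type*} (X : ℝ≥0 → Ω → S) (c : S) {α : ℝ} (hα : 0 < α)
    (m : ℕ) (ω : Ω) : gridDiscountedHitting X c α m ω ∈ Set.Icc (0 : ℝ) 1 := by
  classical
  by_cases h : ∃ k : ℕ, (∀ i < k, X ((i : ℝ≥0) * (2 ^ m)⁻¹) ω ≠ c) ∧ X ((k : ℝ≥0) * (2 ^ m)⁻¹) ω = c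
  · obtain ⟨k, hk⟩ := h
    have hz : ∀ j : ℕ, j ≠ k → Real.exp (-α * (j * ((2 ^ m)⁻¹ : ℝ≥0))) *
        Set.indicator {ω | (∀ i < j, X ((i : ℝ≥0) * (2 ^ m)⁻¹) ω ≠ c) ∧
          X ((j : ℝ≥0) * (2 ^ m)⁻¹) ω = c} (1 : Ω → ℝ) ω = 0 := by
      intro j hj
      rw [Set.indicator_of_notMem, mul_zero]
      rintro ⟨h1, h2⟩
      rcases lt_or_gt_of_ne hj with hlt | hgt
      · exact hk.1 j hlt h2
      · exact h1 k hgt hk.2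
    have hexp : Real.exp (-α * (k * ((2 ^ m)⁻¹ : ℝ≥0))) ≤ 1 := by
      rw [Real.exp_le_one_iff, neg_mul, neg_nonpos]; positivity
    by_cases hmem : k ∈ Finset.range (4 ^ m)
    · rw [gridDiscountedHitting, Finset.sum_eq_single_of_mem k hmem fun j _ hj => hz j hj,
        Set.indicator_of_mem (by exact hk), Pi.one_apply, mul_one]
      exact ⟨(Real.exp_pos _).le, hexp⟩
    · rw [gridDiscountedHitting, Finset.sum_eq_zero fun j hj => hz j fun h => hmem (h ▸ hj)]
      exact ⟨le_rfl, zero_le_one⟩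
  · rw [gridDiscountedHitting, Finset.sum_eq_zero fun j _ => ?_]
    · exact ⟨le_rfl, zero_le_one⟩
    · rw [Set.indicator_of_notMem, mul_zero]
      exact fun hj => h ⟨j, hj⟩

section MarkovChain

variable {S Ω : Type*} [Fintype S] [DecidableEq S] [MeasurableSpace Ω]
  {Q : Matrix S S ℝ} {x₀ : S} {X : ℝ≥0 → Ω → S} {P : Measure Ω}

namespace IsMarkovJumpProcess

theorem measurable_gridDiscountedHitting (hX : IsMarkovJumpProcess Q x₀ X P) (c : S) (α : ℝ)
    (m : ℕ) : Measurable (gridDiscountedHitting X c α m) := by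
  unfold gridDiscountedHitting
  refine Finset.measurable_sum _ fun k _ => Measurable.const_mul ?_ _
  exact measurable_one.indicator
    (hX.measurableSet_firstHit c (fun i => (i : ℝ≥0) * (2 ^ m)⁻¹) k c)

theorem integral_gridDiscountedHitting [IsProbabilityMeasure P]
    (hX : IsMarkovJumpProcess Q x₀ X P) (c : S) (α : ℝ) (m : ℕ) :
    ∫ ω, gridDiscountedHitting X c α m ω ∂P =
      ∑ k ∈ Finset.range (4 ^ m), Real.exp (-α * (k * ((2 ^ m)⁻¹ : ℝ≥0))) *
        P.real {ω | (∀ i < k, X ((i : ℝ≥0) * (2 ^ m)⁻¹) ω ≠ c) ∧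
          X ((k : ℝ≥0) * (2 ^ m)⁻¹) ω = c} := by
  have hm := fun k => hX.measurableSet_firstHit c (fun i => (i : ℝ≥0) * (2 ^ m)⁻¹) k c
  unfold gridDiscountedHitting
  rw [integral_finsetSum]
  · refine Finset.sum_congr rfl fun k _ => ?_
    rw [integral_const_mul]
    congr 1
    exact integral_indicator_one (hm k)
  · exact fun k _ => ((integrable_indicator_iff (hm k)).2
      (integrable_const (1 : ℝ)).integrableOn).const_mul _

theorem aemeasurable_discountedHitting (hX : IsMarkovJumpProcess Q x₀ X P) (c : S) (α : ℝ) :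
    AEMeasurable (discountedHitting X c α) P :=
  aemeasurable_of_tendsto_metrizable_ae atTop
    (fun m => (hX.measurable_gridDiscountedHitting c α m).aemeasurable)
    (hX.rightContinuous.mono fun _ hω => tendsto_gridDiscountedHitting hω α)

/-- If `Q f = α f` away from `c`, then `E[exp (-α T)] f c = f x₀` for the hitting time `T`
of `c`. -/
theorem integral_discountedHitting_mul [IsProbabilityMeasure P]
    (hX : IsMarkovJumpProcess Q x₀ X P) (c : S) (f : S → ℝ) {α : ℝ} (hα : 0 < α)
    (hf : ∀ x, x ≠ c → Q.mulVec f x = α * f x) :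
    (∫ ω, discountedHitting X c α ω ∂P) * f c = f x₀ := by
  have hlim : Tendsto (fun m => ∫ ω, gridDiscountedHitting X c α m ω ∂P) atTop
      (𝓝 (∫ ω, discountedHitting X c α ω ∂P)) := by
    refine tendsto_integral_of_dominated_convergence (fun _ => 1)
      (fun m => (hX.measurable_gridDiscountedHitting c α m).aestronglyMeasurable)
      (integrable_const 1) (fun m => Eventually.of_forall fun ω => ?_)
      (hX.rightContinuous.mono fun _ hω => tendsto_gridDiscountedHitting hω α)
    have h := gridDiscountedHitting_mem_Icc X c hα m ω
    rw [Real.norm_of_nonneg h.1]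
    exact h.2
  have hpow : Tendsto (fun m : ℕ => (((2 ^ m)⁻¹ : ℝ≥0) : ℝ)) atTop (𝓝[≠] 0) := by
    rw [tendsto_nhdsWithin_iff]
    refine ⟨?_, Eventually.of_forall fun m => ?_⟩
    · have := tendsto_pow_atTop_nhds_zero_of_lt_one (r := (1 / 2 : ℝ)) (by norm_num) (by norm_num)
      refine this.congr fun m => ?_
      push_cast
      rw [one_div, inv_pow]
    · simp
  have hpow0 := hpow.mono_right nhdsWithin_le_nhds
  set B : ℝ := ∑ x, |f x| with hBdef
  have hB : ∀ x, |f x| ≤ B := fun x =>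
    Finset.single_le_sum (f := fun x => |f x|) (fun _ _ => abs_nonneg _) (Finset.mem_univ x)
  have hbound : ∀ η : ℝ, 0 < η →
      |f c * (∫ ω, discountedHitting X c α ω ∂P) - f x₀| ≤ η * (1 / α) := by
    intro η hη
    -- Away from `c` the semigroup expansion has zero first-order term, because `Q f = α f`;
    -- finiteness of `S` makes the error uniform.
    have hev : ∀ᶠ m : ℕ in atTop, ∀ x, x ≠ c →
        |Real.exp (-α * ((2 ^ m)⁻¹ : ℝ≥0)) *
          (NormedSpace.exp ((((2 ^ m)⁻¹ : ℝ≥0) : ℝ) • Q)).mulVec f x - f x|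
          ≤ η * ((2 ^ m)⁻¹ : ℝ≥0) := by
      rw [eventually_all]
      intro x
      by_cases hx : x = c
      · exact Eventually.of_forall fun _ h => absurd hx h
      · have h1 := (Q.tendsto_exp_smul_mulVec_div f α x).comp hpow
        rw [hf x hx, sub_self] at h1
        have h2 := h1.abs
        rw [abs_zero] at h2
        filter_upwards [h2.eventually_lt_const hη] with m hm _
        have hp : (0 : ℝ) < ((2 ^ m)⁻¹ : ℝ≥0) := by positivity
        simp only [Function.comp_apply] at hm
        rw [abs_div, abs_of_pos hp, div_lt_iff₀ hp] at hm
        exact hm.le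
    have hlim1 := ((hlim.const_mul (f c)).sub_const (f x₀)).abs
    have hexp : Tendsto (fun m : ℕ => Real.exp (-α * ((4 ^ m : ℕ) * ((2 ^ m)⁻¹ : ℝ≥0)))) atTop
        (𝓝 0) := by
      have h4 : ∀ m : ℕ, ((4 ^ m : ℕ) : ℝ) * ((2 ^ m)⁻¹ : ℝ≥0) = 2 ^ m := by
        intro m
        push_cast
        rw [show (4 : ℝ) = 2 * 2 by norm_num, mul_pow, mul_assoc, mul_inv_cancel₀ (by positivity),
          mul_one]
      simp_rw [h4, neg_mul]
      exact Real.tendsto_exp_neg_atTop_nhds_zero.comp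
        ((tendsto_pow_atTop_atTop_of_one_lt (by norm_num : (1 : ℝ) < 2)).const_mul_atTop hα)
    have hlim2 : Tendsto (fun m : ℕ => η * ((1 + α * (((2 ^ m)⁻¹ : ℝ≥0) : ℝ)) / α)
        + Real.exp (-α * ((4 ^ m : ℕ) * ((2 ^ m)⁻¹ : ℝ≥0))) * B) atTop
        (𝓝 (η * ((1 + α * 0) / α) + 0 * B)) :=
      ((((hpow0.const_mul α).const_add 1).div_const α).const_mul η).add (hexp.mul_const B)
    rw [mul_zero, add_zero, zero_mul, add_zero] at hlim2
    refine le_of_tendsto_of_tendsto hlim1 hlim2 ?_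
    filter_upwards [hev] with m hm
    rw [hX.integral_gridDiscountedHitting]
    exact hX.abs_sum_firstHit_sub_le c f hα ((2 ^ m)⁻¹) (by positivity) hη.le hm hB (4 ^ m)
  have hzero : |f c * (∫ ω, discountedHitting X c α ω ∂P) - f x₀| ≤ 0 := by
    have h0 : Tendsto (fun η : ℝ => η * (1 / α)) (𝓝[>] 0) (𝓝 (0 * (1 / α))) :=
      ((continuous_id.mul continuous_const).tendsto 0).mono_left nhdsWithin_le_nhds
    rw [zero_mul] at h0
    exact ge_of_tendsto h0 (by filter_upwards [self_mem_nhdsWithin] with η hη using hbound η hη)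
  have := abs_nonpos_iff.1 hzero
  linarith

end IsMarkovJumpProcess

end MarkovChain

/-! ### Real analysis: integrals against `u ^ (α - 1)` and expansions of the logarithm. -/

theorem setIntegral_Ioi_comp_mul_mul_rpow (h : ℝ → ℝ) {b : ℝ} (hb : 0 < b) (α : ℝ) :
    ∫ u in Set.Ioi (0 : ℝ), h u * u ^ (α - 1) =
      b ^ α * ∫ u in Set.Ioi (0 : ℝ), h (b * u) * u ^ (α - 1) := by
  have h1 := integral_comp_mul_left_Ioi (fun u => h u * u ^ (α - 1)) 0 hb
  rw [mul_zero] at h1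
  have h2 : ∫ u in Set.Ioi (0 : ℝ), h (b * u) * (b * u) ^ (α - 1)
      = b ^ (α - 1) * ∫ u in Set.Ioi (0 : ℝ), h (b * u) * u ^ (α - 1) := by
    rw [← integral_const_mul]
    refine setIntegral_congr_fun measurableSet_Ioi fun u hu => ?_
    rw [Real.mul_rpow hb.le (le_of_lt hu)]; ring
  rw [h2, smul_eq_mul, eq_inv_mul_iff_mul_eq₀ hb.ne', ← mul_assoc] at h1
  rw [← h1]
  congr 1
  nth_rewrite 1 [← Real.rpow_one b]
  rw [← Real.rpow_add hb]; ring_nf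

theorem integrableOn_Ioc_rpow_sub_one {α : ℝ} (hα : 0 < α) (b : ℝ) :
    IntegrableOn (fun u : ℝ => u ^ (α - 1)) (Set.Ioc 0 b) :=
  (intervalIntegral.intervalIntegrable_rpow' (by linarith)).1

/-- As `α → 0+`, the probability densities `α u ^ (α - 1)` on `(0, 1)` concentrate at `0`. -/
theorem tendsto_mul_setIntegral_mul_rpow {h : ℝ → ℝ} (hint : IntegrableOn h (Set.Ioi 0))
    (hO : (fun u => h u - 1) =O[𝓝[>] 0] fun u => u) :
    Tendsto (fun α : ℝ => α * ∫ u in Set.Ioi (0 : ℝ), h u * u ^ (α - 1)) (𝓝[>] 0) (𝓝 1) := by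
  obtain ⟨K, hK⟩ := hO.bound
  obtain ⟨b, hb0, hb⟩ := mem_nhdsGT_iff_exists_Ioc_subset.1 hK
  have hb0 : 0 < b := hb0
  have hbd : ∀ u ∈ Set.Ioc (0 : ℝ) b, |h u - 1| ≤ K * u := by
    intro u hu
    have := hb hu
    simpa [abs_of_pos hu.1] using this
  have hK0 : 0 ≤ K * b := (abs_nonneg _).trans (hbd b ⟨hb0, le_rfl⟩)
  have hmeas : AEStronglyMeasurable h (volume.restrict (Set.Ioc 0 b)) :=
    (hint.mono_set Set.Ioc_subset_Ioi_self).aestronglyMeasurable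
  -- Comparison with `α ∫_0^b u^(α - 1) du = b^α`. On `(0, b]` the error uses `|h u - 1| ≤ K u`; on
  -- the tail `u^(α - 1) ≤ b^(α - 1)` since `α ≤ 1`. Both contributions carry a factor `α`.
  have hsplit : ∀ α : ℝ, 0 < α → α ≤ 1 →
      |α * (∫ u in Set.Ioi (0 : ℝ), h u * u ^ (α - 1)) - b ^ α|
        ≤ α * (K * b * b ^ α + b ^ (α - 1) * ∫ u in Set.Ioi b, |h u|) := by
    intro α hα hα1
    have hr := integrableOn_Ioc_rpow_sub_one hα b
    have hri : ∫ u in Set.Ioc (0 : ℝ) b, u ^ (α - 1) = b ^ α / α := by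
      rw [← intervalIntegral.integral_of_le hb0.le, integral_rpow (Or.inl (by linarith))]
      rw [sub_add_cancel, Real.zero_rpow hα.ne', sub_zero]
    have hr' : IntegrableOn (fun u : ℝ => u ^ α) (Set.Ioc 0 b) :=
      (intervalIntegral.intervalIntegrable_rpow' (by linarith)).1
    have i1 : IntegrableOn (fun u => (h u - 1) * u ^ (α - 1)) (Set.Ioc 0 b) := by
      refine Integrable.mono' (hr'.const_mul K)
        ((hmeas.sub aestronglyMeasurable_const).mul hr.aestronglyMeasurable) ?_
      filter_upwards [ae_restrict_mem measurableSet_Ioc] with u hu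
      rw [norm_mul, Real.norm_eq_abs, Real.norm_of_nonneg (Real.rpow_nonneg hu.1.le _)]
      calc |h u - 1| * u ^ (α - 1) ≤ K * u * u ^ (α - 1) :=
            mul_le_mul_of_nonneg_right (hbd u hu) (Real.rpow_nonneg hu.1.le _)
        _ = K * u ^ α := by
            rw [mul_assoc, ← Real.rpow_one_add' hu.1.le (by linarith)]; ring_nf
    have hIoi : ∀ u ∈ Set.Ioi b, u ^ (α - 1) ≤ b ^ (α - 1) := fun u hu =>
      Real.rpow_le_rpow_of_nonpos hb0 (le_of_lt hu) (by linarith)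
    have hb_int : IntegrableOn h (Set.Ioi b) := hint.mono_set (Set.Ioi_subset_Ioi hb0.le)
    have hpow_meas : Measurable fun u : ℝ => u ^ (α - 1) := by fun_prop
    have hle : ∀ᵐ u ∂(volume.restrict (Set.Ioi b)),
        ‖h u * u ^ (α - 1)‖ ≤ b ^ (α - 1) * |h u| := by
      filter_upwards [ae_restrict_mem measurableSet_Ioi] with u hu
      have hu0 : 0 ≤ u := hb0.le.trans (le_of_lt hu)
      rw [norm_mul, Real.norm_eq_abs, Real.norm_of_nonneg (Real.rpow_nonneg hu0 _), mul_comm]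
      exact mul_le_mul_of_nonneg_right (hIoi u hu) (abs_nonneg _)
    have i2 : IntegrableOn (fun u => h u * u ^ (α - 1)) (Set.Ioi b) :=
      Integrable.mono' (hb_int.abs.const_mul (b ^ (α - 1)))
        (hb_int.aestronglyMeasurable.mul hpow_meas.aestronglyMeasurable) hle
    have i3 : IntegrableOn (fun u => h u * u ^ (α - 1)) (Set.Ioc 0 b) := by
      refine (i1.add hr).congr_fun (fun u _ => ?_) measurableSet_Ioc
      simp only [Pi.add_apply]; ring
    have e1 : ∫ u in Set.Ioi (0 : ℝ), h u * u ^ (α - 1)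
        = (∫ u in Set.Ioc (0 : ℝ) b, (h u - 1) * u ^ (α - 1)) + b ^ α / α
          + ∫ u in Set.Ioi b, h u * u ^ (α - 1) := by
      rw [← Set.Ioc_union_Ioi_eq_Ioi hb0.le,
        setIntegral_union (Set.Ioc_disjoint_Ioi le_rfl) measurableSet_Ioi i3 i2, ← hri,
        ← integral_add i1 hr]
      congr 1
      refine setIntegral_congr_fun measurableSet_Ioc fun u _ => ?_
      ring
    have b1 : |∫ u in Set.Ioc (0 : ℝ) b, (h u - 1) * u ^ (α - 1)| ≤ K * b * b ^ α := by
      have hKn : 0 ≤ K := nonneg_of_mul_nonneg_left hK0 hb0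
      have h1 := norm_setIntegral_le_of_norm_le_const (μ := volume) (s := Set.Ioc (0 : ℝ) b)
        (f := fun u => (h u - 1) * u ^ (α - 1)) (C := K * b ^ α) (by simp) fun u hu => ?_
      · simp only [Real.norm_eq_abs, Real.volume_real_Ioc_of_le hb0.le, sub_zero] at h1
        linarith
      · rw [norm_mul, Real.norm_eq_abs, Real.norm_of_nonneg (Real.rpow_nonneg hu.1.le _)]
        calc |h u - 1| * u ^ (α - 1) ≤ K * u * u ^ (α - 1) :=
              mul_le_mul_of_nonneg_right (hbd u hu) (Real.rpow_nonneg hu.1.le _)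
          _ = K * u ^ α := by
              rw [mul_assoc, ← Real.rpow_one_add' hu.1.le (by linarith)]; ring_nf
          _ ≤ K * b ^ α :=
              mul_le_mul_of_nonneg_left (Real.rpow_le_rpow hu.1.le hu.2 hα.le) hKn
    have b2 : |∫ u in Set.Ioi b, h u * u ^ (α - 1)| ≤ b ^ (α - 1) * ∫ u in Set.Ioi b, |h u| := by
      rw [← integral_const_mul]
      exact norm_integral_le_of_norm_le (hb_int.abs.const_mul _) hle
    have e2 : α * (∫ u in Set.Ioi (0 : ℝ), h u * u ^ (α - 1)) - b ^ α
        = α * ((∫ u in Set.Ioc (0 : ℝ) b, (h u - 1) * u ^ (α - 1))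
          + ∫ u in Set.Ioi b, h u * u ^ (α - 1)) := by
      rw [e1]; field_simp; ring
    rw [e2, abs_mul, abs_of_pos hα]
    exact mul_le_mul_of_nonneg_left ((abs_add_le _ _).trans (add_le_add b1 b2)) hα.le
  have hid : Tendsto (fun α : ℝ => α) (𝓝[>] 0) (𝓝 0) := tendsto_id.mono_left nhdsWithin_le_nhds
  have hbα : Tendsto (fun α : ℝ => b ^ α) (𝓝[>] 0) (𝓝 1) := by
    have := (Real.continuous_const_rpow hb0.ne').tendsto 0
    rw [Real.rpow_zero] at this
    exact this.mono_left nhdsWithin_le_nhds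
  have hbα1 : Tendsto (fun α : ℝ => b ^ (α - 1)) (𝓝[>] 0) (𝓝 (b ^ ((0 : ℝ) - 1))) :=
    ((Real.continuous_const_rpow hb0.ne').tendsto _).comp (hid.sub_const 1)
  have herr := hid.mul ((hbα.const_mul (K * b)).add (hbα1.mul_const (∫ u in Set.Ioi b, |h u|)))
  rw [zero_mul] at herr
  have hdiff : Tendsto (fun α : ℝ => α * (∫ u in Set.Ioi (0 : ℝ), h u * u ^ (α - 1)) - b ^ α)
      (𝓝[>] 0) (𝓝 0) := by
    refine squeeze_zero_norm' ?_ herr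
    filter_upwards [self_mem_nhdsWithin,
      (eventually_le_nhds (zero_lt_one' ℝ)).filter_mono nhdsWithin_le_nhds] with α h0 h1
    exact hsplit α h0 h1
  simpa using hdiff.add hbα

/-- Keeps two terms of the series of `-log (1 - a)`, whose terms are all nonnegative. The quadratic
one supplies the Gaussian decay in the domination at capacity. -/
theorem one_sub_le_exp_neg_sub_sq {a : ℝ} (h0 : 0 ≤ a) (h1 : a ≤ 1) :
    1 - a ≤ Real.exp (-a - a ^ 2 / 2) := by
  rcases eq_or_lt_of_le h1 with rfl | h1
  · rw [sub_self]; exact (Real.exp_pos _).le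
  · rw [← Real.log_le_iff_le_exp (by linarith)]
    have hs := Real.hasSum_pow_div_log_of_abs_lt_one (x := a) (by rwa [abs_of_nonneg h0])
    have := sum_le_hasSum (Finset.range 2) (fun i _ => by positivity) hs
    norm_num [Finset.sum_range_succ] at this
    linarith

/-- Second order expansion of `log` along `y / √N`, with weights of order `N`. -/
theorem tendsto_mul_log_one_add_div_sqrt (y : ℝ) (m : ℕ → ℝ) (hm : ∀ N, |m N| ≤ N) :
    Tendsto (fun N : ℕ => m N * (Real.log (1 + y / √(N : ℝ)) - y / √(N : ℝ) + y ^ 2 / (2 * N)))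
      atTop (𝓝 0) := by
  have hs : Tendsto (fun N : ℕ => √(N : ℝ)) atTop atTop :=
    Real.tendsto_sqrt_atTop.comp tendsto_natCast_atTop_atTop
  have hlim : Tendsto (fun N : ℕ => 2 * |y| ^ 3 / √(N : ℝ)) atTop (𝓝 0) := hs.const_div_atTop _
  refine squeeze_zero_norm' ?_ hlim
  filter_upwards [hs.eventually_ge_atTop (2 * |y| + 1), eventually_gt_atTop 0] with N hN hN0
  have hN' : (0 : ℝ) < N := by exact_mod_cast hN0
  set s := √(N : ℝ) with hs_def
  have hs0 : 0 < s := Real.sqrt_pos.2 hN'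
  have hss : s ^ 2 = N := Real.sq_sqrt hN'.le
  have hx : |-(y / s)| ≤ 1 / 2 := by
    rw [abs_neg, abs_div, abs_of_pos hs0, div_le_iff₀ hs0]; linarith
  -- The remainder after two terms is at most `|x|^3 / (1 - |x|) ≤ 2 |x|^3` for `|x| ≤ 1/2`; with
  -- `x` of order `1 / √N`, a weight at most `N` leaves `O(1 / √N)`.
  have h1 := Real.abs_log_sub_add_sum_range_le (x := -(y / s)) (by linarith) 2
  have h2 : (∑ i ∈ Finset.range 2, (-(y / s)) ^ (i + 1) / ((i : ℝ) + 1)) + Real.log (1 - -(y / s))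
      = Real.log (1 + y / s) - y / s + y ^ 2 / (2 * N) := by
    rw [← hss]
    norm_num [Finset.sum_range_succ]
    field_simp
    ring
  rw [h2] at h1
  have h3 : |-(y / s)| ^ (2 + 1) / (1 - |-(y / s)|) ≤ 2 * |y| ^ 3 / s ^ 3 := by
    rw [div_le_iff₀ (by linarith)]
    have : |-(y / s)| ^ (2 + 1) = |y| ^ 3 / s ^ 3 := by
      rw [abs_neg, abs_div, abs_of_pos hs0, div_pow]
    rw [this]
    have h4 : 0 ≤ |y| ^ 3 / s ^ 3 := by positivity
    rw [mul_div_assoc]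
    nlinarith
  rw [norm_mul, Real.norm_eq_abs, Real.norm_eq_abs]
  calc _ ≤ (N : ℝ) * (2 * |y| ^ 3 / s ^ 3) :=
        mul_le_mul (hm N) (h1.trans h3) (abs_nonneg _) hN'.le
    _ = 2 * |y| ^ 3 / s := by rw [← hss]; field_simp

/-- Completing the square: half of the quadratic term absorbs the linear one at the cost of the
constant `exp (a^2 / (2 b))`. -/
theorem integrableOn_exp_mul_rpow {a b α : ℝ} (hb : 0 < b) (hα : 0 < α) :
    IntegrableOn (fun u : ℝ => Real.exp (u * a - u ^ 2 * b) * u ^ (α - 1)) (Set.Ioi 0) := by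
  have h1 := (integrableOn_rpow_mul_exp_neg_mul_sq (b := b / 2) (by positivity)
    (s := α - 1) (by linarith)).const_mul (Real.exp (a ^ 2 / (2 * b)))
  refine Integrable.mono' h1 (by fun_prop) ?_
  filter_upwards [ae_restrict_mem measurableSet_Ioi] with u hu
  have hu0 : (0 : ℝ) ≤ u ^ (α - 1) := Real.rpow_nonneg (le_of_lt hu) _
  rw [Real.norm_of_nonneg (mul_nonneg (Real.exp_pos _).le hu0)]
  have : Real.exp (u * a - u ^ 2 * b) ≤ Real.exp (a ^ 2 / (2 * b)) * Real.exp (-(b / 2) * u ^ 2) := by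
    rw [← Real.exp_add, Real.exp_le_exp]
    have h2 : a ^ 2 / (2 * b) + -(b / 2) * u ^ 2 - (u * a - u ^ 2 * b)
        = (a - u * b) ^ 2 / (2 * b) := by field_simp; ring
    have h3 : 0 ≤ (a - u * b) ^ 2 / (2 * b) := by positivity
    linarith
  calc _ ≤ Real.exp (a ^ 2 / (2 * b)) * Real.exp (-(b / 2) * u ^ 2) * u ^ (α - 1) :=
        mul_le_mul_of_nonneg_right this hu0
    _ = _ := by ring

/-! ### The Engset eigenfunction and the Laplace transform of the blocking time. -/

/-- The polynomial `(1 - ν u) ^ (N - x) (1 + (1 - ν) u) ^ x`, cut off at `u = 1 / ν`. -/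
noncomputable def engsetKernel (ν : ℝ) (N x : ℕ) (u : ℝ) : ℝ :=
  Set.indicator (Set.Iic (1 / ν)) (fun u => (1 - ν * u) ^ (N - x) * (1 + (1 - ν) * u) ^ x) u

/-- The eigenfunction of the Engset process, away from the capacity, for the eigenvalue `α`. -/
noncomputable def engsetEigen (ν : ℝ) (N : ℕ) (α : ℝ) (x : ℕ) : ℝ :=
  ∫ u in Set.Ioi (0 : ℝ), engsetKernel ν N x u * u ^ (α - 1)

theorem engsetKernel_eq_of_le {ν : ℝ} {N x : ℕ} {u : ℝ} (hu : u ≤ 1 / ν) :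
    engsetKernel ν N x u = (1 - ν * u) ^ (N - x) * (1 + (1 - ν) * u) ^ x :=
  Set.indicator_of_mem (s := Set.Iic (1 / ν)) hu _

/-- The half-line form with a cut-off suits rescaling and dominated convergence on a fixed domain;
this compact form suits integration by parts. -/
theorem engsetEigen_eq_setIntegral (ν : ℝ) (N : ℕ) (α : ℝ) (x : ℕ) :
    engsetEigen ν N α x = ∫ u in Set.Ioc 0 (1 / ν),
      (1 - ν * u) ^ (N - x) * (1 + (1 - ν) * u) ^ x * u ^ (α - 1) := by
  unfold engsetEigen engsetKernel
  simp_rw [← Set.indicator_mul_left (Set.Iic (1 / ν))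
    (fun u => (1 - ν * u) ^ (N - x) * (1 + (1 - ν) * u) ^ x) (fun u : ℝ => u ^ (α - 1))]
  rw [setIntegral_indicator measurableSet_Iic, Set.Ioi_inter_Iic]

theorem integrableOn_mul_rpow_of_continuous {p : ℝ → ℝ} (hp : Continuous p) {α : ℝ} (hα : 0 < α)
    (b : ℝ) : IntegrableOn (fun u => p u * u ^ (α - 1)) (Set.Ioc 0 b) :=
  ((intervalIntegral.intervalIntegrable_rpow' (a := 0) (b := b)
    (by linarith)).continuousOn_mul hp.continuousOn).1

/-- The eigenfunction equation at a non-blocking state. -/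
theorem engsetEigen_recurrence {ν : ℝ} (hν : 0 < ν) {N : ℕ} {α : ℝ} (hα : 0 < α) {x : ℕ}
    (hx : x < N) :
    ν * ((N : ℝ) - x) * (engsetEigen ν N α (x + 1) - engsetEigen ν N α x)
      + (1 - ν) * x * (engsetEigen ν N α (x - 1) - engsetEigen ν N α x)
      = α * engsetEigen ν N α x := by
  simp only [engsetEigen_eq_setIntegral]
  obtain ⟨a, rfl⟩ : ∃ a, N = x + 1 + a := Nat.exists_eq_add_of_le hx
  set p : ℝ → ℝ := fun u => (1 - ν * u) ^ (a + 1) * (1 + (1 - ν) * u) ^ x with hp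
  set p' : ℝ → ℝ := fun u => -(ν * (a + 1)) * (1 - ν * u) ^ a * (1 + (1 - ν) * u) ^ x
    + (1 - ν * u) ^ (a + 1) * ((1 - ν) * x * (1 + (1 - ν) * u) ^ (x - 1)) with hp'
  have hpc : Continuous p := by fun_prop
  have hpc' : Continuous p' := by fun_prop
  have hb : (0 : ℝ) ≤ 1 / ν := by positivity
  have hderiv : ∀ u, HasDerivAt p (p' u) u := by
    intro u
    have h1 : HasDerivAt (fun u : ℝ => 1 - ν * u) (-ν) u := by
      simpa using ((hasDerivAt_id u).const_mul ν).const_sub 1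
    have h2 : HasDerivAt (fun u : ℝ => 1 + (1 - ν) * u) (1 - ν) u := by
      simpa using ((hasDerivAt_id u).const_mul (1 - ν)).const_add 1
    refine ((h1.pow (a + 1)).mul (h2.pow x)).congr_deriv ?_
    simp only [hp', Nat.add_sub_cancel, Pi.pow_apply]
    push_cast
    ring
  -- The integrand is the derivative of `p u * u ^ α`, which vanishes at `0` because `α > 0` and at
  -- `1 / ν` because the exponent `N - x = a + 1` is positive: this is where `x < N` enters.
  have hparts : ∫ u in Set.Ioc 0 (1 / ν), (p' u * u ^ α + α * (p u * u ^ (α - 1))) = 0 := by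
    have i1 : IntegrableOn (fun u => p' u * u ^ α + α * (p u * u ^ (α - 1))) (Set.Ioc 0 (1 / ν)) := by
      have h1 := integrableOn_mul_rpow_of_continuous hpc' (α := α + 1) (by linarith) (1 / ν)
      simp only [add_sub_cancel_right] at h1
      exact h1.add ((integrableOn_mul_rpow_of_continuous hpc hα (1 / ν)).const_mul α)
    rw [← intervalIntegral.integral_of_le hb,
      intervalIntegral.integral_eq_sub_of_hasDerivAt_of_le (f := fun u => p u * u ^ α) hb]
    · simp only [hp]
      rw [Real.zero_rpow hα.ne', mul_one_div_cancel hν.ne', sub_self, zero_pow (Nat.succ_ne_zero a)]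
      ring
    · exact hpc.continuousOn.mul (Real.continuous_rpow_const hα.le).continuousOn
    · intro u hu
      refine ((hderiv u).mul
        (Real.hasDerivAt_rpow_const (p := α) (Or.inl hu.1.ne'))).congr_deriv ?_
      ring
    · exact (intervalIntegrable_iff_integrableOn_Ioc_of_le hb).2 i1
  have hcont : ∀ n m : ℕ, Continuous fun u : ℝ => (1 - ν * u) ^ n * (1 + (1 - ν) * u) ^ m :=
    fun n m => by fun_prop
  have hI : ∀ n m : ℕ, IntegrableOn
      (fun u : ℝ => (1 - ν * u) ^ n * (1 + (1 - ν) * u) ^ m * u ^ (α - 1)) (Set.Ioc 0 (1 / ν)) :=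
    fun n m => integrableOn_mul_rpow_of_continuous (hcont n m) hα _
  refine sub_eq_zero.1 (neg_eq_zero.1 (Eq.trans ?_ hparts))
  rw [← integral_sub (hI _ _) (hI _ _),
    ← integral_sub (hI _ _) (hI _ _), ← integral_const_mul, ← integral_const_mul,
    ← integral_const_mul, ← integral_add, ← integral_sub, ← integral_neg]
  · refine setIntegral_congr_fun measurableSet_Ioc fun u hu => ?_
    have hu : 0 < u := hu.1
    have e1 : x + 1 + a - (x + 1) = a := by omega
    have e2 : x + 1 + a - x = a + 1 := by omega
    have hpow : u ^ α = u * u ^ (α - 1) := by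
      rw [← Real.rpow_one_add' hu.le (by linarith)]; ring_nf
    simp only [hp, hp', e1, e2, hpow]
    push_cast
    rcases Nat.eq_zero_or_pos x with rfl | hx0
    · simp only [Nat.cast_zero]
      ring
    · obtain ⟨y, rfl⟩ : ∃ y, x = y + 1 := ⟨x - 1, by omega⟩
      have e3 : y + 1 + 1 + a - y = a + 2 := by omega
      simp only [Nat.add_sub_cancel, e3]
      push_cast
      ring
  · exact (((hI _ _).sub (hI _ _)).const_mul _).add (((hI _ _).sub (hI _ _)).const_mul _)
  · exact (hI _ _).const_mul _
  · exact ((hI _ _).sub (hI _ _)).const_mul _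
  · exact ((hI _ _).sub (hI _ _)).const_mul _

/-- The truncated `x - 1` at `x = 0` is harmless, being multiplied by the death rate `μ * 0`. The
capacity is excluded since births are suppressed there. -/
theorem engsetQ_mulVec (ν μ : ℝ) (N C : ℕ) (F : ℕ → ℝ) {x : Fin (C + 1)} (hx : x ≠ Fin.last C) :
    (engsetQ ν μ N C).mulVec (fun y => F y) x
      = ν * ((N : ℝ) - (x : ℕ)) * (F (x + 1) - F x) + μ * (x : ℕ) * (F (x - 1) - F x) := by
  have hxC : (x : ℕ) < C := by
    have := x.2
    have h2 : (x : ℕ) ≠ C := fun h => hx (Fin.ext h)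
    omega
  have hsplit : ∀ y : Fin (C + 1), engsetQ ν μ N C x y * F y
      = (if y = ⟨x + 1, by omega⟩ then ν * ((N : ℝ) - (x : ℕ)) * F (x + 1) else 0)
        + (if (y : ℕ) + 1 = x then μ * (x : ℕ) * F (x - 1) else 0)
        + (if y = x then -(ν * ((N : ℝ) - (x : ℕ)) + μ * (x : ℕ)) * F x else 0) := by
    intro y
    simp only [engsetQ, Matrix.of_apply, if_pos hxC, Fin.ext_iff]
    by_cases h1 : (y : ℕ) = x + 1
    · have h2 : ¬ (y : ℕ) + 1 = x := by omega
      have h3 : ¬ (y : ℕ) = x := by omega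
      rw [if_pos h1, if_pos h1, if_neg h2, if_neg h3, h1]; ring
    · by_cases h2 : (y : ℕ) + 1 = x
      · have h3 : ¬ (y : ℕ) = x := by omega
        have h4 : (y : ℕ) = x - 1 := by omega
        rw [if_neg h1, if_neg h1, if_pos h2, if_pos h2, if_neg h3, h4]; ring
      · by_cases h3 : (y : ℕ) = x
        · simp only [if_neg h1, if_neg h2, if_pos h3]; rw [h3]; ring
        · simp only [if_neg h1, if_neg h2, if_neg h3]; ring
  simp only [Matrix.mulVec, dotProduct, hsplit, Finset.sum_add_distrib, Finset.sum_ite_eq',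
    Finset.mem_univ, if_true]
  have hmid : ∑ y : Fin (C + 1), (if (y : ℕ) + 1 = x then μ * (x : ℕ) * F (x - 1) else 0)
      = μ * (x : ℕ) * F (x - 1) := by
    rcases Nat.eq_zero_or_pos (x : ℕ) with h0 | h0
    · simp [h0]
    · have hy : ∀ y : Fin (C + 1), ((y : ℕ) + 1 = x) = (y = ⟨x - 1, by omega⟩) := by
        intro y
        rw [Fin.ext_iff, eq_iff_iff]
        exact ⟨fun h => by simp only; omega, fun h => by simp only at h; omega⟩
      simp only [hy, Finset.sum_ite_eq', Finset.mem_univ, if_true]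
  rw [hmid]
  ring

theorem engsetEigen_pos {ν : ℝ} (hν : 0 < ν) (hν1 : ν < 1) (N : ℕ) {α : ℝ} (hα : 0 < α) (x : ℕ) :
    0 < engsetEigen ν N α x := by
  have hb : (0 : ℝ) < 1 / ν := by positivity
  rw [engsetEigen_eq_setIntegral, ← intervalIntegral.integral_of_le hb.le]
  refine intervalIntegral.intervalIntegral_pos_of_pos_on ?_ (fun u hu => ?_) hb
  · rw [intervalIntegrable_iff_integrableOn_Ioc_of_le hb.le]
    exact integrableOn_mul_rpow_of_continuous (by fun_prop) hα _
  · have h1 : ν * u < 1 := by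
      have := mul_lt_mul_of_pos_left hu.2 hν
      rwa [mul_one_div_cancel hν.ne'] at this
    have h2 : 0 ≤ (1 - ν) * u := mul_nonneg (by linarith) hu.1.le
    exact mul_pos (mul_pos (pow_pos (by linarith) _) (pow_pos (by linarith) _))
      (Real.rpow_pos_of_pos hu.1 _)

/-- Every kernel equals `1` at `u = 0` and is differentiable there. As the limit does not depend on
`x`, the ratio of eigenfunctions tends to `1` as `α → 0+`. -/
theorem tendsto_mul_engsetEigen {ν : ℝ} (hν : 0 < ν) (N x : ℕ) :
    Tendsto (fun α : ℝ => α * engsetEigen ν N α x) (𝓝[>] 0) (𝓝 1) := by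
  refine tendsto_mul_setIntegral_mul_rpow (h := engsetKernel ν N x) ?_ ?_
  · unfold engsetKernel
    rw [IntegrableOn, integrable_indicator_iff measurableSet_Iic, IntegrableOn,
      Measure.restrict_restrict measurableSet_Iic, Set.inter_comm, Set.Ioi_inter_Iic]
    exact (Continuous.integrableOn_Icc (by fun_prop)).mono_set Set.Ioc_subset_Icc_self
  · have hd : DifferentiableAt ℝ
        (fun u : ℝ => (1 - ν * u) ^ (N - x) * (1 + (1 - ν) * u) ^ x) 0 := by fun_prop
    have hO := hd.isBigO_sub.mono (nhdsWithin_le_nhds (s := Set.Ioi 0))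
    simp only [mul_zero, sub_zero, add_zero, one_pow, mul_one] at hO
    refine hO.congr' ?_ EventuallyEq.rfl
    have : ∀ᶠ u : ℝ in 𝓝[>] 0, u ≤ 1 / ν :=
      (eventually_le_nhds (by positivity)).filter_mono nhdsWithin_le_nhds
    filter_upwards [this] with u hu
    rw [engsetKernel_eq_of_le hu]

section Blocking

variable {Ω : Type*} [MeasurableSpace Ω] {P : Measure Ω} [IsProbabilityMeasure P] {ν : ℝ} {N C : ℕ}
  {X : ℝ≥0 → Ω → Fin (C + 1)}

/-- The Laplace transform of the first blocking time of the Engset process. -/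
theorem integral_discountedHitting_engset (hν : 0 < ν) (hν1 : ν < 1) (hCN : C ≤ N)
    (hX : IsMarkovJumpProcess (engsetQ ν (1 - ν) N C) 0 X P) {α : ℝ} (hα : 0 < α) :
    ∫ ω, discountedHitting X (Fin.last C) α ω ∂P = engsetEigen ν N α 0 / engsetEigen ν N α C := by
  rw [eq_div_iff (engsetEigen_pos hν hν1 N hα C).ne']
  refine hX.integral_discountedHitting_mul (Fin.last C) (fun y => engsetEigen ν N α y) hα
    fun x hx => ?_
  rw [engsetQ_mulVec _ _ _ _ _ hx]
  refine engsetEigen_recurrence hν hα ?_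
  have := x.2
  have h2 : (x : ℕ) ≠ C := fun h => hx (Fin.ext h)
  omega

theorem discountedHitting_mem_Icc {S Ω : Type*} (X : ℝ≥0 → Ω → S) (c : S) {α : ℝ} (hα : 0 < α)
    (ω : Ω) : discountedHitting X c α ω ∈ Set.Icc (0 : ℝ) 1 := by
  unfold discountedHitting
  split_ifs
  · exact ⟨le_rfl, zero_le_one⟩
  · refine ⟨(Real.exp_pos _).le, ?_⟩
    rw [Real.exp_le_one_iff, neg_mul, neg_nonpos]; positivity

/-- The Engset process reaches its capacity almost surely. -/
theorem ae_blockingTime_ne_top (hν : 0 < ν) (hν1 : ν < 1) (hCN : C ≤ N)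
    (hX : IsMarkovJumpProcess (engsetQ ν (1 - ν) N C) 0 X P) :
    ∀ᵐ ω ∂P, blockingTime X ω ≠ ⊤ := by
  classical
  -- `g` is the indicator of `T < ⊤`, the pointwise limit of `exp (-α T)` as `α → 0+`.
  set g : Ω → ℝ := fun ω => if hittingAfter X {Fin.last C} 0 ω = ⊤ then 0 else 1 with hg
  have hseq : Tendsto (fun n : ℕ => 1 / ((n : ℝ) + 1)) atTop (𝓝[>] 0) := by
    rw [tendsto_nhdsWithin_iff]
    exact ⟨tendsto_one_div_add_atTop_nhds_zero_nat, Eventually.of_forall fun n => by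
      simp only [Set.mem_Ioi]; positivity⟩
  have hpos : ∀ n : ℕ, (0 : ℝ) < 1 / ((n : ℝ) + 1) := fun n => by positivity
  have hpt : ∀ ω, Tendsto (fun n : ℕ => discountedHitting X (Fin.last C) (1 / ((n : ℝ) + 1)) ω)
      atTop (𝓝 (g ω)) := by
    intro ω
    simp only [discountedHitting, hg]
    split_ifs
    · exact tendsto_const_nhds
    · have h1 := (tendsto_one_div_add_atTop_nhds_zero_nat (𝕜 := ℝ)).neg.mul_const
        ((((hittingAfter X {Fin.last C} 0 ω).untopD 0 : ℝ≥0) : ℝ))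
      have h2 := (Real.continuous_exp.tendsto _).comp h1
      simpa [Function.comp_def] using h2
  have hmeas : AEMeasurable g P := aemeasurable_of_tendsto_metrizable_ae atTop
    (fun n : ℕ => hX.aemeasurable_discountedHitting (Fin.last C) (1 / ((n : ℝ) + 1)))
    (Eventually.of_forall hpt)
  have hlim1 : Tendsto (fun n : ℕ => ∫ ω, discountedHitting X (Fin.last C) (1 / ((n : ℝ) + 1)) ω ∂P)
      atTop (𝓝 (∫ ω, g ω ∂P)) := by
    refine tendsto_integral_of_dominated_convergence (fun _ => 1)
      (fun n => (hX.aemeasurable_discountedHitting _ _).aestronglyMeasurable)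
      (integrable_const 1) (fun n => Eventually.of_forall fun ω => ?_) (Eventually.of_forall hpt)
    have h := discountedHitting_mem_Icc X (Fin.last C) (hpos n) ω
    rw [Real.norm_of_nonneg h.1]
    exact h.2
  have hlim2 : Tendsto (fun n : ℕ => ∫ ω, discountedHitting X (Fin.last C) (1 / ((n : ℝ) + 1)) ω ∂P)
      atTop (𝓝 1) := by
    have h := ((tendsto_mul_engsetEigen hν N 0).div (tendsto_mul_engsetEigen hν N C)
      one_ne_zero).comp hseq
    rw [div_one] at h
    refine h.congr fun n => ?_
    rw [integral_discountedHitting_engset hν hν1 hCN hX (hpos n)]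
    simp only [Function.comp_apply, Pi.div_apply]
    rw [mul_div_mul_left _ _ (hpos n).ne']
  have hone : ∫ ω, g ω ∂P = 1 := tendsto_nhds_unique hlim1 hlim2
  have hgb : ∀ ω, 0 ≤ 1 - g ω := by
    intro ω; simp only [hg]; split_ifs <;> norm_num
  have hgi : Integrable g P := Integrable.of_bound hmeas.aestronglyMeasurable 1
    (Eventually.of_forall fun ω => by simp only [hg]; split_ifs <;> norm_num)
  have hzero : ∫ ω, (1 - g ω) ∂P = 0 := by
    rw [integral_sub (integrable_const 1) hgi, hone]; simp
  rw [integral_eq_zero_iff_of_nonneg hgb ((integrable_const 1).sub hgi)] at hzero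
  filter_upwards [hzero] with ω hω h
  simp only [hg, Pi.zero_apply] at hω
  rw [if_pos (show hittingAfter X {Fin.last C} 0 ω = ⊤ from h)] at hω
  norm_num at hω

end Blocking

/-! ### Asymptotics of the eigenfunction at the empty state and at capacity. -/

theorem measurable_engsetKernel (ν : ℝ) (N x : ℕ) : Measurable (engsetKernel ν N x) :=
  Measurable.indicator (by fun_prop) measurableSet_Iic

/-- The substitution `u = v / (ν s)` moves the cut-off to `v = s`. It is used with `s = N` at state
`0` and `s = √N` at capacity. -/
theorem engsetKernel_inv_mul_of_le {ν s v : ℝ} (hν : 0 < ν) (hs : 0 < s) (hv : v ≤ s) (N x : ℕ) :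
    engsetKernel ν N x ((ν * s)⁻¹ * v)
      = (1 - v / s) ^ (N - x) * (1 + (1 - ν) / ν * v / s) ^ x := by
  rw [engsetKernel_eq_of_le]
  · congr 2 <;> field_simp
  · rw [inv_mul_eq_div, div_le_div_iff₀ (by positivity) hν]; nlinarith

theorem engsetKernel_inv_mul_of_lt {ν s v : ℝ} (hν : 0 < ν) (hs : 0 < s) (hv : s < v) (N x : ℕ) :
    engsetKernel ν N x ((ν * s)⁻¹ * v) = 0 := by
  refine Set.indicator_of_notMem (s := Set.Iic (1 / ν)) ?_ _
  rw [Set.mem_Iic, not_le, inv_mul_eq_div, div_lt_div_iff₀ hν (by positivity)]; nlinarith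

theorem rpow_mul_engsetEigen {ν s : ℝ} (hν : 0 < ν) (hs : 0 < s) (N : ℕ) (α : ℝ) (x : ℕ) :
    (ν * s) ^ α * engsetEigen ν N α x
      = ∫ v in Set.Ioi (0 : ℝ), engsetKernel ν N x ((ν * s)⁻¹ * v) * v ^ (α - 1) := by
  have hp : 0 < ν * s := mul_pos hν hs
  rw [engsetEigen, setIntegral_Ioi_comp_mul_mul_rpow _ (inv_pos.2 hp), ← mul_assoc,
    ← Real.mul_rpow hp.le (inv_pos.2 hp).le, mul_inv_cancel₀ hp.ne', Real.one_rpow, one_mul]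

/-- After rescaling the kernel is `(1 - v / N)^N` on `v ≤ N`, which tends to `exp (-v)` and is
bounded by it. -/
theorem tendsto_engsetEigen_zero {ν : ℝ} (hν : 0 < ν) {α : ℝ} (hα : 0 < α) :
    Tendsto (fun N : ℕ => (ν * N) ^ α * engsetEigen ν N α 0) atTop (𝓝 (Real.Gamma α)) := by
  rw [Real.Gamma_eq_integral hα]
  have hcongr : ∀ᶠ N : ℕ in atTop,
      ∫ v in Set.Ioi (0 : ℝ), engsetKernel ν N 0 ((ν * N)⁻¹ * v) * v ^ (α - 1)
        = (ν * N) ^ α * engsetEigen ν N α 0 := by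
    filter_upwards [eventually_gt_atTop 0] with N hN
    rw [rpow_mul_engsetEigen hν (by exact_mod_cast hN)]
  refine Tendsto.congr' hcongr ?_
  refine tendsto_integral_filter_of_dominated_convergence
    (fun v => Real.exp (-v) * v ^ (α - 1)) ?_ ?_ (Real.GammaIntegral_convergent hα) ?_
  · refine Eventually.of_forall fun N => Measurable.aestronglyMeasurable ?_
    exact ((measurable_engsetKernel ν N 0).comp (by fun_prop)).mul (by fun_prop)
  · filter_upwards [eventually_gt_atTop 0] with N hN
    have hN' : (0 : ℝ) < N := by exact_mod_cast hN
    filter_upwards [ae_restrict_mem measurableSet_Ioi] with v hv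
    have hv0 : (0 : ℝ) ≤ v ^ (α - 1) := Real.rpow_nonneg (le_of_lt hv) _
    rw [norm_mul, Real.norm_of_nonneg hv0]
    refine mul_le_mul_of_nonneg_right ?_ hv0
    rcases le_or_gt v N with h | h
    · rw [engsetKernel_inv_mul_of_le hν hN' h, pow_zero, mul_one, Nat.sub_zero,
        Real.norm_of_nonneg (pow_nonneg (sub_nonneg.2 (div_le_one_of_le₀ h hN'.le)) _)]
      exact Real.one_sub_div_pow_le_exp_neg h
    · rw [engsetKernel_inv_mul_of_lt hν hN' h, norm_zero]
      exact (Real.exp_pos _).le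
  · refine Eventually.of_forall fun v => Tendsto.mul_const _ ?_
    refine (Real.tendsto_one_add_div_pow_exp (-v)).congr' ?_
    filter_upwards [eventually_gt_atTop 0, eventually_ge_atTop ⌈v⌉₊] with N hN hNv
    have hN' : (0 : ℝ) < N := by exact_mod_cast hN
    rw [engsetKernel_inv_mul_of_le hν hN' (Nat.ceil_le.1 hNv), pow_zero, mul_one, Nat.sub_zero,
      neg_div, sub_eq_add_neg]

/-- With `κ = (1 - ν) / ν`, the logarithm of the rescaled kernel has linear part `v (C - ν N) / (ν
√N) → v δ / ν`: the terms of order `√N` cancel because `C / N → ν` at the right rate. Its quadratic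
part tends to `-(v^2 / 2) (1 - ν + κ^2 ν) = -(v^2 / 2) κ`. -/
theorem tendsto_engsetEigen_capacity {ν δ : ℝ} (hν : 0 < ν) (hν1 : ν < 1) {C : ℕ → ℕ}
    (hCN : ∀ N, C N ≤ N)
    (hC : (fun N : ℕ => (C N : ℝ) - ν * N - δ * √(N : ℝ)) =o[atTop] fun N : ℕ => √(N : ℝ))
    {α : ℝ} (hα : 0 < α) :
    Tendsto (fun N : ℕ => (ν * √(N : ℝ)) ^ α * engsetEigen ν N α (C N)) atTop
      (𝓝 (∫ u in Set.Ioi (0 : ℝ),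
        Real.exp (u * (δ / ν) - u ^ 2 / 2 * ((1 - ν) / ν)) * u ^ (α - 1))) := by
  set κ := (1 - ν) / ν with hκ
  have hκ0 : 0 < κ := div_pos (by linarith) hν
  have hsqrt : ∀ N : ℕ, 0 < N → 0 < √(N : ℝ) ∧ √(N : ℝ) ^ 2 = N := fun N hN =>
    ⟨Real.sqrt_pos.2 (by exact_mod_cast hN), Real.sq_sqrt (Nat.cast_nonneg N)⟩
  have hs : Tendsto (fun N : ℕ => √(N : ℝ)) atTop atTop :=
    Real.tendsto_sqrt_atTop.comp tendsto_natCast_atTop_atTop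
  set d : ℕ → ℝ := fun N => ((C N : ℝ) - ν * N) / √(N : ℝ) with hd_def
  have hd : Tendsto d atTop (𝓝 δ) := by
    have h1 := hC.tendsto_div_nhds_zero.add_const δ
    rw [zero_add] at h1
    refine h1.congr' ?_
    filter_upwards [eventually_gt_atTop 0] with N hN
    have := (hsqrt N hN).1
    simp only [hd_def]
    field_simp
    ring
  have hr : Tendsto (fun N : ℕ => (C N : ℝ) / N) atTop (𝓝 ν) := by
    have h1 := (hd.div_atTop hs).add_const ν
    rw [zero_add] at h1
    refine h1.congr' ?_
    filter_upwards [eventually_gt_atTop 0] with N hN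
    obtain ⟨h0, h2⟩ := hsqrt N hN
    have hN' : (0 : ℝ) < N := by exact_mod_cast hN
    simp only [hd_def]
    rw [div_div, ← sq, h2]
    field_simp
    ring
  have hsub : ∀ N : ℕ, ((N - C N : ℕ) : ℝ) = N - C N := fun N => Nat.cast_sub (hCN N)
  have hquad : ∀ N : ℕ, 0 < N → ∀ v : ℝ,
      ((N - C N : ℕ) : ℝ) * (-(v / √(N : ℝ)) ) + C N * (κ * v / √(N : ℝ)) = v * (d N / ν) := by
    intro N hN v
    obtain ⟨h0, h2⟩ := hsqrt N hN
    rw [hsub]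
    simp only [hd_def, hκ]
    field_simp
    ring
  have hcongr : ∀ᶠ N : ℕ in atTop,
      ∫ v in Set.Ioi (0 : ℝ), engsetKernel ν N (C N) ((ν * √(N : ℝ))⁻¹ * v) * v ^ (α - 1)
        = (ν * √(N : ℝ)) ^ α * engsetEigen ν N α (C N) := by
    filter_upwards [eventually_gt_atTop 0] with N hN
    rw [rpow_mul_engsetEigen hν (hsqrt N hN).1]
  refine Tendsto.congr' hcongr ?_
  refine tendsto_integral_filter_of_dominated_convergence
    -- Eventually `d N < |δ| + 1` and `C / N < (1 + ν) / 2`, the latter giving `(1 - C / N) / 2 ≥ (1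
    -- - ν) / 4`. All the Gaussian decay comes from the factor with exponent `N - C`; the other is
    -- bounded by `1 + x ≤ exp x`.
    (fun v => Real.exp (v * ((|δ| + 1) / ν) - v ^ 2 * ((1 - ν) / 4)) * v ^ (α - 1)) ?_ ?_
    (integrableOn_exp_mul_rpow (by linarith) hα) ?_
  · refine Eventually.of_forall fun N => Measurable.aestronglyMeasurable ?_
    exact ((measurable_engsetKernel ν N _).comp (by fun_prop)).mul (by fun_prop)
  · have hd1 : ∀ᶠ N in atTop, d N < |δ| + 1 :=
      hd.eventually_lt_const (by linarith [le_abs_self δ])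
    have hr1 : ∀ᶠ N : ℕ in atTop, (C N : ℝ) / N < (1 + ν) / 2 :=
      hr.eventually_lt_const (by linarith)
    filter_upwards [eventually_gt_atTop 0, hd1, hr1] with N hN hd1 hr1
    obtain ⟨h0, h2⟩ := hsqrt N hN
    have hN' : (0 : ℝ) < N := by exact_mod_cast hN
    filter_upwards [ae_restrict_mem measurableSet_Ioi] with v hv
    have hv : 0 < v := hv
    have hv0 : (0 : ℝ) ≤ v ^ (α - 1) := Real.rpow_nonneg hv.le _
    rw [norm_mul, Real.norm_of_nonneg hv0]
    refine mul_le_mul_of_nonneg_right ?_ hv0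
    rcases le_or_gt v (√(N : ℝ)) with h | h
    · rw [engsetKernel_inv_mul_of_le hν h0 h, ← hκ]
      have ha0 : 0 ≤ v / √(N : ℝ) := by positivity
      have ha1 : v / √(N : ℝ) ≤ 1 := div_le_one_of_le₀ h h0.le
      have hb0 : 0 ≤ κ * v / √(N : ℝ) := by positivity
      rw [Real.norm_of_nonneg (mul_nonneg (pow_nonneg (by linarith) _) (pow_nonneg (by linarith) _))]
      calc (1 - v / √(N : ℝ)) ^ (N - C N) * (1 + κ * v / √(N : ℝ)) ^ C N
          ≤ Real.exp (-(v / √(N : ℝ)) - (v / √(N : ℝ)) ^ 2 / 2) ^ (N - C N)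
            * Real.exp (κ * v / √(N : ℝ)) ^ C N := by
            gcongr
            · exact one_sub_le_exp_neg_sub_sq ha0 ha1
            · linarith [Real.add_one_le_exp (κ * v / √(N : ℝ))]
        _ = Real.exp (v * (d N / ν) - v ^ 2 * ((1 - (C N : ℝ) / N) / 2)) := by
            rw [← Real.exp_nat_mul, ← Real.exp_nat_mul, ← Real.exp_add, ← hquad N hN v, div_pow, h2,
              hsub]
            congr 1
            field_simp
            ring
        _ ≤ Real.exp (v * ((|δ| + 1) / ν) - v ^ 2 * ((1 - ν) / 4)) := by
            have e1 : d N / ν ≤ (|δ| + 1) / ν := div_le_div_of_nonneg_right hd1.le hν.le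
            have e2 : (1 - ν) / 4 ≤ (1 - (C N : ℝ) / N) / 2 := by linarith
            rw [Real.exp_le_exp]
            have := mul_le_mul_of_nonneg_left e1 hv.le
            have := mul_le_mul_of_nonneg_left e2 (sq_nonneg v)
            linarith
    · rw [engsetKernel_inv_mul_of_lt hν h0 h, norm_zero]
      exact (Real.exp_pos _).le
  · filter_upwards [ae_restrict_mem measurableSet_Ioi] with v hv
    have hv : 0 < v := hv
    refine Tendsto.mul_const _ ?_
    have l1 := tendsto_mul_log_one_add_div_sqrt (-v) (fun N => ((N - C N : ℕ) : ℝ)) fun N => by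
      rw [abs_of_nonneg (Nat.cast_nonneg _)]; exact_mod_cast Nat.sub_le _ _
    have l2 := tendsto_mul_log_one_add_div_sqrt (κ * v) (fun N => (C N : ℝ)) fun N => by
      rw [abs_of_nonneg (Nat.cast_nonneg _)]; exact_mod_cast hCN N
    have l3 : Tendsto (fun N : ℕ => v * (d N / ν)
        - v ^ 2 / 2 * (1 - (C N : ℝ) / N + κ ^ 2 * ((C N : ℝ) / N))) atTop
        (𝓝 (v * (δ / ν) - v ^ 2 / 2 * (1 - ν + κ ^ 2 * ν))) :=
      ((hd.div_const ν).const_mul v).sub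
        (((hr.const_sub 1).add (hr.const_mul (κ ^ 2))).const_mul (v ^ 2 / 2))
    have l4 := (l1.add l2).add l3
    have e : 0 + 0 + (v * (δ / ν) - v ^ 2 / 2 * (1 - ν + κ ^ 2 * ν))
        = v * (δ / ν) - v ^ 2 / 2 * κ := by
      rw [hκ]; field_simp; ring
    rw [e] at l4
    refine ((Real.continuous_exp.tendsto _).comp l4).congr' ?_
    filter_upwards [eventually_gt_atTop 0, hs.eventually_gt_atTop v] with N hN hvs
    obtain ⟨h0, h2⟩ := hsqrt N hN
    have hN' : (0 : ℝ) < N := by exact_mod_cast hN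
    rw [engsetKernel_inv_mul_of_le hν h0 hvs.le, ← hκ]
    have ha1 : 0 < 1 - v / √(N : ℝ) := by rw [sub_pos, div_lt_one h0]; exact hvs
    have hb1 : 0 < 1 + κ * v / √(N : ℝ) := by positivity
    rw [← Real.exp_log (mul_pos (pow_pos ha1 (N - C N)) (pow_pos hb1 (C N))),
      Real.log_mul (pow_pos ha1 _).ne' (pow_pos hb1 _).ne', Real.log_pow, Real.log_pow]
    simp only [Function.comp_apply]
    congr 1
    rw [← hquad N hN v, neg_div, ← sub_eq_add_neg, hsub]
    field_simp
    ring

/-- The limit of the Laplace transforms of the recentred blocking times. -/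
theorem tendsto_engset_laplace {ν δ : ℝ} (hν : 0 < ν) (hν1 : ν < 1) {C : ℕ → ℕ}
    (hCN : ∀ N, C N ≤ N)
    (hC : (fun N : ℕ => (C N : ℝ) - ν * N - δ * √(N : ℝ)) =o[atTop] fun N : ℕ => √(N : ℝ))
    {α : ℝ} (hα : 0 < α) :
    Tendsto (fun N : ℕ => Real.exp (α * (Real.log N / 2)) *
        (engsetEigen ν N α 0 / engsetEigen ν N α (C N))) atTop
      (𝓝 (Real.Gamma α / ∫ u in Set.Ioi (0 : ℝ),
        Real.exp (u * (δ / ν) - u ^ 2 / 2 * ((1 - ν) / ν)) * u ^ (α - 1))) := by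
  have hI : 0 < ∫ u in Set.Ioi (0 : ℝ),
      Real.exp (u * (δ / ν) - u ^ 2 / 2 * ((1 - ν) / ν)) * u ^ (α - 1) := by
    have hb : 0 < (1 - ν) / ν / 2 := by
      have : 0 < 1 - ν := by linarith
      positivity
    have hint : IntegrableOn (fun u : ℝ =>
        Real.exp (u * (δ / ν) - u ^ 2 / 2 * ((1 - ν) / ν)) * u ^ (α - 1)) (Set.Ioi 0) := by
      refine (integrableOn_exp_mul_rpow (a := δ / ν) hb hα).congr_fun (fun u _ => ?_)
        measurableSet_Ioi
      simp only
      congr 2; ring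
    have hpos : ∀ u ∈ Set.Ioi (0 : ℝ),
        0 < Real.exp (u * (δ / ν) - u ^ 2 / 2 * ((1 - ν) / ν)) * u ^ (α - 1) := fun u hu =>
      mul_pos (Real.exp_pos _) (Real.rpow_pos_of_pos hu _)
    rw [setIntegral_pos_iff_support_of_nonneg_ae ?_ hint]
    · refine lt_of_lt_of_le ?_ (measure_mono (s := Set.Ioi (0 : ℝ)) fun u hu =>
        ⟨Function.mem_support.2 (hpos u hu).ne', hu⟩)
      simp
    · filter_upwards [ae_restrict_mem measurableSet_Ioi] with u hu using (hpos u hu).le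
  refine ((tendsto_engsetEigen_zero hν hα).div (tendsto_engsetEigen_capacity hν hν1 hCN hC hα)
    hI.ne').congr' ?_
  filter_upwards [eventually_gt_atTop 0] with N hN
  have hN' : (0 : ℝ) < N := by exact_mod_cast hN
  have h0 : 0 < √(N : ℝ) := Real.sqrt_pos.2 hN'
  have hpow : Real.exp (α * (Real.log N / 2)) = √(N : ℝ) ^ α := by
    rw [← Real.log_sqrt hN'.le, mul_comm, Real.rpow_def_of_pos h0]
  -- The two normalisations differ by `√N ^ α`, exactly the factor produced by centring at `log N /
  -- 2`.
  have hsplit : (ν * (N : ℝ)) ^ α = √(N : ℝ) ^ α * (ν * √(N : ℝ)) ^ α := by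
    rw [← Real.mul_rpow h0.le (by positivity)]
    congr 1
    nth_rewrite 1 [← Real.mul_self_sqrt hN'.le]
    ring
  have hp : 0 < (ν * √(N : ℝ)) ^ α := by positivity
  have hf := engsetEigen_pos hν hν1 N hα (C N)
  simp only [Pi.div_apply]
  rw [hpow, hsplit]
  field_simp

/-- Numerator and denominator are both equivalent to `1 / α`. This is the hypothesis that yields
tightness, so that no mass escapes in the limit. -/
theorem tendsto_laplace_limit_zero {ν : ℝ} (δ : ℝ) (hν : 0 < ν) (hν1 : ν < 1) :
    Tendsto (fun α : ℝ => Real.Gamma α / ∫ u in Set.Ioi (0 : ℝ),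
        Real.exp (u * (δ / ν) - u ^ 2 / 2 * ((1 - ν) / ν)) * u ^ (α - 1)) (𝓝[>] 0) (𝓝 1) := by
  have hG : Tendsto (fun α : ℝ => α * Real.Gamma α) (𝓝[>] 0) (𝓝 1) := by
    have h1 : Tendsto (fun α : ℝ => Real.Gamma (α + 1)) (𝓝 0) (𝓝 (Real.Gamma (0 + 1))) := by
      have h2 : ContinuousAt Real.Gamma (0 + 1) :=
        (Real.differentiableAt_Gamma fun m => by
          have : (0 : ℝ) ≤ m := Nat.cast_nonneg m
          intro h; linarith).continuousAt
      exact h2.tendsto.comp ((continuous_id.add continuous_const).tendsto (0 : ℝ))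
    rw [zero_add, Real.Gamma_one] at h1
    refine (h1.mono_left nhdsWithin_le_nhds).congr' ?_
    filter_upwards [self_mem_nhdsWithin] with α hα
    exact Real.Gamma_add_one (ne_of_gt hα)
  have hI : Tendsto (fun α : ℝ => α * ∫ u in Set.Ioi (0 : ℝ),
      Real.exp (u * (δ / ν) - u ^ 2 / 2 * ((1 - ν) / ν)) * u ^ (α - 1)) (𝓝[>] 0) (𝓝 1) := by
    refine tendsto_mul_setIntegral_mul_rpow ?_ ?_
    · have hb : 0 < (1 - ν) / ν / 2 := by
        have : 0 < 1 - ν := by linarith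
        positivity
      have h := integrableOn_exp_mul_rpow (a := δ / ν) hb one_pos
      refine h.congr_fun (fun u _ => ?_) measurableSet_Ioi
      simp only [sub_self, Real.rpow_zero, mul_one]
      congr 1; ring
    · have hd : DifferentiableAt ℝ
          (fun u : ℝ => Real.exp (u * (δ / ν) - u ^ 2 / 2 * ((1 - ν) / ν))) 0 := by fun_prop
      have hO := hd.isBigO_sub.mono (nhdsWithin_le_nhds (s := Set.Ioi 0))
      simpa using hO
  have h := hG.div hI one_ne_zero
  rw [div_one] at h
  refine h.congr' ?_
  filter_upwards [self_mem_nhdsWithin] with α hα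
  simp only [Pi.div_apply]
  rw [mul_div_mul_left _ _ (ne_of_gt hα)]

/-! ### The limit law for `δ = 0`. -/

/-- The density of the recentred limiting blocking time in the case `δ = 0`. -/
noncomputable def criticalDensity (x : ℝ) : ℝ :=
  √(2 / Real.pi) * Real.exp (-x - Real.exp (-2 * x) / 2)

theorem criticalDensity_nonneg (x : ℝ) : 0 ≤ criticalDensity x := by
  unfold criticalDensity; positivity

theorem measurable_criticalDensity : Measurable criticalDensity := by
  unfold criticalDensity; fun_prop

/-- Prepares the substitution `y = exp (-x)`, under which the density becomes that of `|G|` for a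
standard Gaussian `G`, and the Laplace transform becomes the moment of order `α` of `|G|`. -/
theorem criticalDensity_mul_exp (α x : ℝ) :
    criticalDensity x * Real.exp (-α * x) = |-Real.exp (-x)| •
      (√(2 / Real.pi) * (Real.exp (-x) ^ α * Real.exp (-(1 / 2) * Real.exp (-x) ^ (2 : ℝ)))) := by
  rw [abs_neg, abs_of_pos (Real.exp_pos _), smul_eq_mul, ← Real.exp_mul, ← Real.exp_mul,
    criticalDensity]
  have e : -x - Real.exp (-2 * x) / 2 + -α * x
      = -x + (-x * α + -(1 / 2) * Real.exp (-x * 2)) := by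
    rw [show -2 * x = -x * 2 by ring]; ring
  rw [mul_assoc, ← Real.exp_add, e, Real.exp_add, Real.exp_add]
  ring

theorem image_exp_neg_univ : (fun x : ℝ => Real.exp (-x)) '' Set.univ = Set.Ioi 0 := by
  ext y
  simp only [Set.image_univ, Set.mem_range, Set.mem_Ioi]
  exact ⟨fun ⟨x, hx⟩ => hx ▸ Real.exp_pos _, fun hy => ⟨-Real.log y, by
    simp only [neg_neg]; exact Real.exp_log hy⟩⟩

theorem hasDerivWithinAt_exp_neg (x : ℝ) :
    HasDerivWithinAt (fun x : ℝ => Real.exp (-x)) (-Real.exp (-x)) Set.univ x := by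
  have := (hasDerivAt_neg x).exp
  simpa using this

theorem injOn_exp_neg : Set.InjOn (fun x : ℝ => Real.exp (-x)) Set.univ := fun x _ y _ h => by
  simpa using h

theorem integrable_criticalDensity_mul_exp {α : ℝ} (hα : -1 < α) :
    Integrable fun x => criticalDensity x * Real.exp (-α * x) := by
  have h := (integrableOn_image_iff_integrableOn_abs_deriv_smul MeasurableSet.univ
    (fun x _ => hasDerivWithinAt_exp_neg x) injOn_exp_neg
    (fun y => √(2 / Real.pi) * (y ^ α * Real.exp (-(1 / 2) * y ^ (2 : ℝ))))).1 ?_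
  · rw [integrableOn_univ] at h
    simp_rw [criticalDensity_mul_exp]
    exact h
  · rw [image_exp_neg_univ]
    exact (integrableOn_rpow_mul_exp_neg_mul_rpow hα two_pos (by norm_num)).const_mul _

theorem integral_criticalDensity_mul_exp {α : ℝ} (hα : -1 < α) :
    ∫ x, criticalDensity x * Real.exp (-α * x)
      = √(2 / Real.pi) * ((1 / 2) ^ (-(α + 1) / 2) * (1 / 2) * Real.Gamma ((α + 1) / 2)) := by
  have h := integral_image_eq_integral_abs_deriv_smul MeasurableSet.univ
    (fun x _ => hasDerivWithinAt_exp_neg x) injOn_exp_neg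
    (fun y => √(2 / Real.pi) * (y ^ α * Real.exp (-(1 / 2) * y ^ (2 : ℝ))))
  rw [image_exp_neg_univ, integral_const_mul,
    integral_rpow_mul_exp_neg_mul_rpow two_pos hα (by norm_num), setIntegral_univ] at h
  rw [h]
  simp_rw [criticalDensity_mul_exp]

/-- Legendre's duplication formula at `α / 2` trades `Γ((α + 1) / 2)` for `Γ(α) / Γ(α / 2)`, the
form in which the limit transform appears. -/
theorem criticalDensity_laplace_eq {α : ℝ} (hα : 0 < α) :
    √(2 / Real.pi) * ((1 / 2) ^ (-(α + 1) / 2) * (1 / 2) * Real.Gamma ((α + 1) / 2))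
      = 2 * 2 ^ (-(α / 2)) * Real.Gamma α / Real.Gamma (α / 2) := by
  have hd := Real.Gamma_mul_Gamma_add_half (α / 2)
  rw [show α / 2 + 1 / 2 = (α + 1) / 2 by ring, show 2 * (α / 2) = α by ring] at hd
  have hG : 0 < Real.Gamma (α / 2) := Real.Gamma_pos_of_pos (by positivity)
  have hpi : 0 < √Real.pi := Real.sqrt_pos.2 Real.pi_pos
  have h2 : (0 : ℝ) < 2 := two_pos
  have e1 : ((1 : ℝ) / 2) ^ (-(α + 1) / 2) = 2 ^ ((α + 1) / 2) := by
    rw [one_div, Real.inv_rpow h2.le, ← Real.rpow_neg h2.le]; ring_nf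
  have e2 : √(2 : ℝ) * 2 ^ ((α + 1) / 2) * (1 / 2) = 2 ^ (α / 2) := by
    rw [Real.sqrt_eq_rpow, one_div, ← Real.rpow_neg_one, ← Real.rpow_add h2, ← Real.rpow_add h2]
    ring_nf
  have e3 : (2 : ℝ) ^ (α / 2) * 2 ^ (1 - α) = 2 * 2 ^ (-(α / 2)) := by
    rw [← Real.rpow_add h2, show α / 2 + (1 - α) = 1 + -(α / 2) by ring, Real.rpow_add h2,
      Real.rpow_one]
  rw [Real.sqrt_div h2.le, e1, eq_div_iff hG.ne', ← e3]
  calc √2 / √Real.pi * (2 ^ ((α + 1) / 2) * (1 / 2) * Real.Gamma ((α + 1) / 2))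
        * Real.Gamma (α / 2)
      = (√2 * 2 ^ ((α + 1) / 2) * (1 / 2)) / √Real.pi
        * (Real.Gamma (α / 2) * Real.Gamma ((α + 1) / 2)) := by ring
    _ = 2 ^ (α / 2) * 2 ^ (1 - α) * Real.Gamma α := by
      rw [e2, hd]; field_simp

/-- The law with density `criticalDensity`. -/
noncomputable def criticalLaw : Measure ℝ :=
  volume.withDensity fun x => ENNReal.ofReal (criticalDensity x)

theorem integral_criticalLaw (g : ℝ → ℝ) :
    ∫ x, g x ∂criticalLaw = ∫ x, criticalDensity x * g x := by
  rw [criticalLaw, integral_withDensity_eq_integral_toReal_smul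
    measurable_criticalDensity.ennreal_ofReal (by simp)]
  simp_rw [ENNReal.toReal_ofReal (criticalDensity_nonneg _), smul_eq_mul]

instance isProbabilityMeasure_criticalLaw : IsProbabilityMeasure criticalLaw := by
  constructor
  have h1 := integrable_criticalDensity_mul_exp (α := 0) (by norm_num)
  have h2 := integral_criticalDensity_mul_exp (α := 0) (by norm_num)
  simp only [neg_zero, zero_mul, Real.exp_zero, mul_one] at h1 h2
  rw [criticalLaw, withDensity_apply _ MeasurableSet.univ, Measure.restrict_univ,
    ← ofReal_integral_eq_lintegral_ofReal h1 (Eventually.of_forall criticalDensity_nonneg), h2]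
  have hpi : 0 < √Real.pi := Real.sqrt_pos.2 Real.pi_pos
  have e : √(2 / Real.pi) * ((1 / 2) ^ (-(0 + 1) / 2 : ℝ) * (1 / 2) * Real.Gamma ((0 + 1) / 2))
      = 1 := by
    have e1 : ((1 : ℝ) / 2) ^ (-(0 + 1) / 2 : ℝ) = √2 := by
      rw [one_div, Real.inv_rpow two_pos.le, ← Real.rpow_neg two_pos.le, Real.sqrt_eq_rpow]
      norm_num
    rw [e1, zero_add, Real.Gamma_one_half_eq, Real.sqrt_div two_pos.le]
    field_simp
    exact Real.sq_sqrt two_pos.le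
  rw [e, ENNReal.ofReal_one]

theorem integrable_exp_criticalLaw {α : ℝ} (hα : -1 < α) :
    Integrable (fun x => Real.exp (-α * x)) criticalLaw := by
  rw [criticalLaw, integrable_withDensity_iff measurable_criticalDensity.ennreal_ofReal (by simp)]
  refine (integrable_criticalDensity_mul_exp hα).congr (Eventually.of_forall fun x => ?_)
  simp only [ENNReal.toReal_ofReal (criticalDensity_nonneg _)]
  ring

/-- Identification of the limit law in the case `δ = 0`. -/
theorem map_sub_eq_criticalLaw {ν : ℝ} (hν : 0 < ν) (hν1 : ν < 1) {ρ : Measure ℝ}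
    [IsProbabilityMeasure ρ]
    (hρ : ∀ α : ℝ, 0 < α → Integrable (fun x => Real.exp (-α * x)) ρ ∧
      ∫ x, Real.exp (-α * x) ∂ρ = Real.Gamma α / ∫ u in Set.Ioi (0 : ℝ),
        Real.exp (u * (0 / ν) - u ^ 2 / 2 * ((1 - ν) / ν)) * u ^ (α - 1)) :
    ρ.map (fun x => x - Real.log (ν / (1 - ν)) / 2) = criticalLaw := by
  have hmeas : Measurable fun x : ℝ => x - Real.log (ν / (1 - ν)) / 2 := by fun_prop
  have : IsProbabilityMeasure (ρ.map fun x : ℝ => x - Real.log (ν / (1 - ν)) / 2) :=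
    Measure.isProbabilityMeasure_map hmeas.aemeasurable
  have hμ : 0 < 1 - ν := by linarith
  have hexp : ∀ α x : ℝ, Real.exp (-α * (x - Real.log (ν / (1 - ν)) / 2))
      = (ν / (1 - ν)) ^ (α / 2) * Real.exp (-α * x) := by
    intro α x
    rw [Real.rpow_def_of_pos (div_pos hν hμ), ← Real.exp_add]
    ring_nf
  refine ext_of_integral_exp_neg_mul_eq (fun α hα => ?_)
    (fun α hα => integrable_exp_criticalLaw (by linarith)) fun α hα => ?_
  · rw [integrable_map_measure (by fun_prop) hmeas.aemeasurable]
    simp only [Function.comp_def, hexp]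
    exact (hρ α hα).1.const_mul _
  · rw [integral_map hmeas.aemeasurable (by fun_prop), integral_criticalLaw,
      integral_criticalDensity_mul_exp (by linarith), criticalDensity_laplace_eq hα]
    simp_rw [hexp]
    rw [integral_const_mul, (hρ α hα).2]
    have hI := integral_rpow_mul_exp_neg_mul_rpow (p := 2) (q := α - 1) (b := (1 - ν) / ν / 2)
      two_pos (by linarith) (by positivity)
    have hI2 : ∫ u in Set.Ioi (0 : ℝ),
        Real.exp (u * (0 / ν) - u ^ 2 / 2 * ((1 - ν) / ν)) * u ^ (α - 1)
        = ((1 - ν) / ν / 2) ^ (-(α - 1 + 1) / 2) * (1 / 2) * Real.Gamma ((α - 1 + 1) / 2) := by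
      rw [← hI]
      refine setIntegral_congr_fun measurableSet_Ioi fun u _ => ?_
      simp only [Real.rpow_two]
      rw [mul_comm]
      congr 2
      ring
    rw [hI2, sub_add_cancel]
    have hG : 0 < Real.Gamma (α / 2) := Real.Gamma_pos_of_pos (by positivity)
    -- The power of `ν / (1 - ν)` here cancels the one created by the shift by `log (ν / (1 - ν)) /
    -- 2`.
    have e1 : ((1 - ν) / ν / 2) ^ (-α / 2) = (ν / (1 - ν)) ^ (α / 2) * 2 ^ (α / 2) := by
      rw [neg_div, Real.rpow_neg (by positivity), ← Real.inv_rpow (by positivity),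
        ← Real.mul_rpow (by positivity) (by positivity)]
      congr 1
      field_simp
    have hp1 : 0 < (ν / (1 - ν)) ^ (α / 2) := by positivity
    have hp2 : (0 : ℝ) < 2 ^ (α / 2) := by positivity
    rw [e1, Real.rpow_neg two_pos.le]
    field_simp

/-! ### Assembly: the recentred blocking times. -/

section Blocking

variable {Ω : Type*} [MeasurableSpace Ω] {P : Measure Ω} [IsProbabilityMeasure P] {ν : ℝ} {N C : ℕ}
  {X : ℝ≥0 → Ω → Fin (C + 1)}

/-- Almost surely `T = -log (exp (-T))`, and the discounted time at `α = 1` is an almost sure limit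
of measurable grid sums. -/
theorem aemeasurable_blockingTime (hν : 0 < ν) (hν1 : ν < 1) (hCN : C ≤ N)
    (hX : IsMarkovJumpProcess (engsetQ ν (1 - ν) N C) 0 X P) :
    AEMeasurable (fun ω => (((blockingTime X ω).untopD 0 : ℝ≥0) : ℝ)) P := by
  have h := (hX.aemeasurable_discountedHitting (Fin.last C) 1).log.neg
  refine h.congr ?_
  filter_upwards [ae_blockingTime_ne_top hν hν1 hCN hX] with ω hω
  simp only [Pi.neg_apply, discountedHitting]
  rw [if_neg (show ¬ hittingAfter X {Fin.last C} 0 ω = ⊤ from hω), Real.log_exp]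
  simp [blockingTime]

/-- The Laplace transform of the recentred blocking time. -/
theorem integral_exp_blockingTime_sub (hν : 0 < ν) (hν1 : ν < 1) (hCN : C ≤ N)
    (hX : IsMarkovJumpProcess (engsetQ ν (1 - ν) N C) 0 X P) {α : ℝ} (hα : 0 < α) (c : ℝ) :
    Integrable (fun ω => Real.exp (-α * ((((blockingTime X ω).untopD 0 : ℝ≥0) : ℝ) - c))) P ∧
    ∫ ω, Real.exp (-α * ((((blockingTime X ω).untopD 0 : ℝ≥0) : ℝ) - c)) ∂P =
      Real.exp (α * c) * (engsetEigen ν N α 0 / engsetEigen ν N α C) := by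
  have hae : (fun ω => Real.exp (α * c) * discountedHitting X (Fin.last C) α ω) =ᵐ[P]
      fun ω => Real.exp (-α * ((((blockingTime X ω).untopD 0 : ℝ≥0) : ℝ) - c)) := by
    filter_upwards [ae_blockingTime_ne_top hν hν1 hCN hX] with ω hω
    rw [discountedHitting, if_neg (show ¬ hittingAfter X {Fin.last C} 0 ω = ⊤ from hω),
      ← Real.exp_add]
    congr 1
    simp only [blockingTime]
    ring
  constructor
  · refine Integrable.congr (Integrable.const_mul ?_ _) hae
    refine Integrable.of_bound (hX.aemeasurable_discountedHitting _ α).aestronglyMeasurable 1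
      (Eventually.of_forall fun ω => ?_)
    have h := discountedHitting_mem_Icc X (Fin.last C) hα ω
    rw [Real.norm_of_nonneg h.1]
    exact h.2
  · rw [← integral_congr_ae hae, integral_const_mul,
      integral_discountedHitting_engset hν hν1 hCN hX hα]

end Blocking

theorem mainTheorem7 (ν δ : ℝ) (hν0 : 0 < ν) (hν1 : ν < 1)
    (C : ℕ → ℕ) (hCN : ∀ N, C N ≤ N)
    (hC : (fun N : ℕ => (C N : ℝ) - ν * N - δ * √(N : ℝ)) =o[atTop] fun N : ℕ => √(N : ℝ))
    {Ω : ℕ → Type*} [∀ N, MeasurableSpace (Ω N)]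
    (P : ∀ N, Measure (Ω N)) [∀ N, IsProbabilityMeasure (P N)]
    (X : ∀ N, ℝ≥0 → Ω N → Fin (C N + 1))
    (hX : ∀ N, IsMarkovJumpProcess (engsetQ ν (1 - ν) N (C N)) 0 (X N) (P N)) :
    (∀ N, ∀ᵐ ω ∂(P N), blockingTime (X N) ω ≠ ⊤) ∧
    ∃ (Ω' : Type) (_ : MeasurableSpace Ω') (P' : Measure Ω') (_ : IsProbabilityMeasure P')
      (Z : Ω' → ℝ),
      TendstoInDistribution
        (fun (N : ℕ) ω => (((blockingTime (X N) ω).untopD 0 : ℝ≥0) : ℝ) - Real.log N / 2)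
        atTop Z P P' ∧
      (∀ α : ℝ, 0 < α →
        Integrable (fun ω => Real.exp (-α * Z ω)) P' ∧
        ∫ ω, Real.exp (-α * Z ω) ∂P' =
          Real.Gamma α /
            ∫ u in Set.Ioi (0 : ℝ),
              Real.exp (u * (δ / ν) - u ^ 2 / 2 * ((1 - ν) / ν)) * u ^ (α - 1)) ∧
      (δ = 0 →
        P'.map (fun ω => Z ω - Real.log (ν / (1 - ν)) / 2) =
          volume.withDensity fun x : ℝ =>
            ENNReal.ofReal (√(2 / Real.pi) * Real.exp (-x - Real.exp (-2 * x) / 2))) := by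
  have hY : ∀ N, AEMeasurable
      (fun ω => (((blockingTime (X N) ω).untopD 0 : ℝ≥0) : ℝ) - Real.log N / 2) (P N) := fun N =>
    (aemeasurable_blockingTime hν0 hν1 (hCN N) (hX N)).sub_const _
  have hlap := fun (N : ℕ) (α : ℝ) (hα : 0 < α) =>
    integral_exp_blockingTime_sub hν0 hν1 (hCN N) (hX N) hα (Real.log N / 2)
  obtain ⟨ρ, hρ, hρα⟩ := exists_tendsto_of_tendsto_laplace
    (fun N => ⟨(P N).map _, Measure.isProbabilityMeasure_map (hY N)⟩)
    (fun α => Real.Gamma α / ∫ u in Set.Ioi (0 : ℝ),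
      Real.exp (u * (δ / ν) - u ^ 2 / 2 * ((1 - ν) / ν)) * u ^ (α - 1))
    (fun N α hα => by
      rw [ProbabilityMeasure.coe_mk, integrable_map_measure (by fun_prop) (hY N)]
      exact (hlap N α hα).1)
    (fun α hα => by
      refine (tendsto_engset_laplace hν0 hν1 hCN hC hα).congr fun N => ?_
      rw [ProbabilityMeasure.coe_mk, integral_map (hY N) (by fun_prop), (hlap N α hα).2])
    (tendsto_laplace_limit_zero δ hν0 hν1)
  -- `Z` is realised as the identity on `ℝ` equipped with the limit law `ρ`.
  refine ⟨fun N => ae_blockingTime_ne_top hν0 hν1 (hCN N) (hX N), ℝ, inferInstance, ρ,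
    inferInstance, id, ⟨hY, aemeasurable_id, ?_⟩, hρα, fun hδ => ?_⟩
  · convert hρ using 2
    exact congrArg _ (Subtype.ext Measure.map_id)
  · subst hδ
    exact map_sub_eq_criticalLaw hν0 hν1 hρα
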